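/- Let $G$ be a finite simple undirected graph with distance function $d$; $G$ need not be connected, and all distances occurring below are between vertices of the same connected component. $G$ is *weakly modular* if it satisfies - the *triangle condition*: whenever $u,v,w\in V(G)$, $d(u,v)=d(u,w)=k\ge 1$ and $vw\in E(G)$, there is $x\in V(G)$ with $d(u,x)=k-1$ and $xv,xw\in E(G)$; and - the *quadrangle condition*: whenever $u,v,w,z\in V(G)$, $d(u,v)=d(u,w)=k\ge 1$, $d(u,z)=k+1$ and $vz,wz\in E(G)$, there is $x\in V(G)$ with $d(u,x)=k-1$ and $xv,xw\in E(G)$. A set $H\subseteq V(G)$ is *convex* if it contains every vertex that lies on a shortest path between two vertices of $H$. $G$ is *bridged* if for every convex set $H$ the closed neighbourhood $N[H]$ ($H$ together with all vertices adjacent to a vertex of $H$) is convex. Two shortest $s$–$t$ paths $P,Q$ in $G$ are *reconfigurable* if there is a sequence $P=P_0,P_1,\dots,P_k=Q$ ($k\ge 0$) of shortest $s$–$t$ paths in which consecutive paths differ in exactly one vertex. In the problem SPR one is given $G$ (by its adjacency matrix), $s$, $t$ and two shortest $s$–$t$ paths $P,Q$; one has to decide whether $P$ and $Q$ are reconfigurable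 and, if they are, to output a reconfiguration sequence as a list of moves, each move naming a position on the current path and the new vertex at this position. **Theorem.** SPR restricted to weakly modular graphs with $n$ vertices can be solved in $O(n^2)$ time. **Corollary.** SPR restricted to bridged graphs with $n$ vertices can be solved in $O(n^2)$ time. Here time is the number of steps of a single fixed program (independent of $n$) on a random access machine with words of $O(\log n)$ bits, where each assignment, addition, subtraction, multiplication, memory access, output of a word and comparison is one step. -/

import Mathlib

namespace SPR

/-! ### Graph classes -/

section Graphs

variable {V : Type*}

/-- The triangle and the quadrangle condition. The distance of the paper's vertices `v`, `w` from
`u` is written `k + 1` here, so that the distance of `x` from `u` is `k`. A positive value of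
`SimpleGraph.dist` is a genuine distance (it is `0` between different components). -/
structure WeaklyModular (G : SimpleGraph V) : Prop where
  triangle : ∀ (k : ℕ) (u v w : V), G.dist u v = k + 1 → G.dist u w = k + 1 → G.Adj v w →
    ∃ x, G.dist u x = k ∧ G.Adj x v ∧ G.Adj x w
  quadrangle : ∀ (k : ℕ) (u v w z : V), G.dist u v = k + 1 → G.dist u w = k + 1 →
    G.dist u z = k + 2 → G.Adj v z → G.Adj w z →
    ∃ x, G.dist u x = k ∧ G.Adj x v ∧ G.Adj x w

/-- The interval `I(u, v)`: all vertices on shortest `u`-`v` paths. -/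
def interval (G : SimpleGraph V) (u v : V) : Set V :=
  {w | G.Reachable u w ∧ G.Reachable w v ∧ G.dist u w + G.dist w v = G.dist u v}

/-- Geodesically convex vertex sets. -/
def IsConvex (G : SimpleGraph V) (H : Set V) : Prop :=
  ∀ u ∈ H, ∀ v ∈ H, interval G u v ⊆ H

/-- The (closed) neighbourhood of a vertex set. -/
def nbhd (G : SimpleGraph V) (H : Set V) : Set V :=
  {v | v ∈ H ∨ ∃ u ∈ H, G.Adj u v}

/-- Bridged graphs: neighbourhoods of convex sets are convex. -/
def Bridged (G : SimpleGraph V) : Prop :=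
  ∀ H : Set V, IsConvex G H → IsConvex G (nbhd G H)

/-! ### Shortest path reconfiguration -/

/-- The vertex sequence `p 0, …, p ℓ` is a shortest path from `s` to `t`. -/
structure IsShortestPath (G : SimpleGraph V) (s t : V) {ℓ : ℕ} (p : Fin (ℓ + 1) → V) : Prop where
  source : p 0 = s
  target : p (Fin.last ℓ) = t
  adj : ∀ i : Fin ℓ, G.Adj (p i.castSucc) (p i.succ)
  length_eq : ℓ = G.dist s t

/-- `P` can be transformed to `Q` through `s`-`t` shortest paths `R 0 = P, …, R k = Q`, where
consecutive ones differ in exactly one vertex. -/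
def Reconfigurable (G : SimpleGraph V) (s t : V) {ℓ : ℕ} (P Q : Fin (ℓ + 1) → V) : Prop :=
  ∃ (k : ℕ) (R : Fin (k + 1) → Fin (ℓ + 1) → V),
    R 0 = P ∧ R (Fin.last k) = Q ∧ (∀ j, IsShortestPath G s t (R j)) ∧
    ∀ j : Fin k, ∃! i, R j.castSucc i ≠ R j.succ i

/-- A list of moves, a move `(i, v)` replacing the vertex at position `i` of the current path by a
different vertex `v`, transforms `P` to `Q` and meets only `s`-`t` shortest paths on the way. -/
def IsReconfiguration (G : SimpleGraph V) (s t : V) {ℓ : ℕ} (Q : Fin (ℓ + 1) → V) :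
    (Fin (ℓ + 1) → V) → List (Fin (ℓ + 1) × V) → Prop
  | P, [] => IsShortestPath G s t P ∧ P = Q
  | P, (i, v) :: M => IsShortestPath G s t P ∧ v ≠ P i ∧
      IsReconfiguration G s t Q (Function.update P i v) M

end Graphs

/-! ### Random access machines -/

/-- A configuration: finitely many of the registers are used by a given program; `mem` is the
random access memory; `out` is the write-only output. -/
structure State where
  reg : ℕ → ℕ
  mem : ℕ → ℕ
  out : List ℕ

/-- Elementary instructions; `r`, `a`, `b` are names of registers. -/
inductive Instr
  /-- `r := k` -/
  | const (r k : ℕ)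
  /-- `r := a` -/
  | move (r a : ℕ)
  /-- `r := a + b` -/
  | add (r a b : ℕ)
  /-- `r := a - b` (truncated) -/
  | sub (r a b : ℕ)
  /-- `r := a * b` -/
  | mul (r a b : ℕ)
  /-- `r := mem[a]` -/
  | load (r a : ℕ)
  /-- `mem[a] := b` -/
  | store (a b : ℕ)
  /-- append the content of `a` to the output -/
  | print (a : ℕ)

/-- Put `x` into register `r`. Words hold numbers below `W`; the machine breaks down when `x` does
not fit into a word. -/
def State.assign (W : ℕ) (σ : State) (r x : ℕ) : Option State :=
  if x < W then some { σ with reg := Function.update σ.reg r x } else none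

/-- Effect of an instruction on a machine with words `0, …, W - 1`. -/
def Instr.run (W : ℕ) (σ : State) : Instr → Option State
  | const r k => σ.assign W r k
  | move r a => σ.assign W r (σ.reg a)
  | add r a b => σ.assign W r (σ.reg a + σ.reg b)
  | sub r a b => σ.assign W r (σ.reg a - σ.reg b)
  | mul r a b => σ.assign W r (σ.reg a * σ.reg b)
  | load r a => σ.assign W r (σ.mem (σ.reg a))
  | store a b => some { σ with mem := Function.update σ.mem (σ.reg a) (σ.reg b) }
  | print a => some { σ with out := σ.out ++ [σ.reg a] }

/-- Tests compare two registers. -/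
inductive Test
  | lt (a b : ℕ)
  | eq (a b : ℕ)

def Test.Holds (σ : State) : Test → Prop
  | lt a b => σ.reg a < σ.reg b
  | eq a b => σ.reg a = σ.reg b

/-- Programs of the machine. -/
inductive Prog
  | skip
  | instr (c : Instr)
  | seq (p q : Prog)
  | cond (b : Test) (p q : Prog)
  | loop (b : Test) (p : Prog)

/-- `Exec W p σ τ σ'`: on a machine with words `0, …, W - 1`, the program `p`, started in `σ`,
halts in `σ'` after `τ` steps. Every execution of an instruction and every evaluation of a test
is one step. -/
inductive Exec (W : ℕ) : Prog → State → ℕ → State → Prop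
  | skip (σ : State) : Exec W .skip σ 0 σ
  | instr (c : Instr) (σ σ' : State) (h : c.run W σ = some σ') : Exec W (.instr c) σ 1 σ'
  | seq (p q : Prog) (σ σ₁ σ₂ : State) (τ₁ τ₂ : ℕ) (h₁ : Exec W p σ τ₁ σ₁)
      (h₂ : Exec W q σ₁ τ₂ σ₂) : Exec W (.seq p q) σ (τ₁ + τ₂) σ₂
  | condTrue (b : Test) (p q : Prog) (σ σ' : State) (τ : ℕ) (hb : b.Holds σ)
      (h : Exec W p σ τ σ') : Exec W (.cond b p q) σ (τ + 1) σ'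
  | condFalse (b : Test) (p q : Prog) (σ σ' : State) (τ : ℕ) (hb : ¬ b.Holds σ)
      (h : Exec W q σ τ σ') : Exec W (.cond b p q) σ (τ + 1) σ'
  | loopStop (b : Test) (p : Prog) (σ : State) (hb : ¬ b.Holds σ) : Exec W (.loop b p) σ 1 σ
  | loopStep (b : Test) (p : Prog) (σ σ₁ σ₂ : State) (τ₁ τ₂ : ℕ) (hb : b.Holds σ)
      (h₁ : Exec W p σ τ₁ σ₁) (h₂ : Exec W (.loop b p) σ₁ τ₂ σ₂) :
      Exec W (.loop b p) σ (τ₁ + τ₂ + 1) σ₂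

/-! ### Solving SPR on a machine -/

open Classical in
/-- An instance of SPR as a list of numbers: the number `n` of vertices, the length `ℓ` of the
paths, `s`, `t`, the vertices of `P`, the vertices of `Q`, and the adjacency matrix of `G`, row by
row. -/
noncomputable def encodeInstance {n : ℕ} (G : SimpleGraph (Fin n)) (s t : Fin n) {ℓ : ℕ}
    (P Q : Fin (ℓ + 1) → Fin n) : List ℕ :=
  [n, ℓ, (s : ℕ), (t : ℕ)] ++ List.ofFn (fun i => (P i : ℕ)) ++ List.ofFn (fun i => (Q i : ℕ)) ++
    List.ofFn (fun e : Fin (n * n) => if G.Adj e.divNat e.modNat then 1 else 0)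

/-- The initial configuration: the input in the first cells of the memory, zeros elsewhere. -/
def initState (input : List ℕ) : State where
  reg := fun _ => 0
  mem := fun a => input.getD a 0
  out := []

/-- A list of moves as a list of numbers. -/
def encodeMoves {n ℓ : ℕ} (M : List (Fin (ℓ + 1) × Fin n)) : List ℕ :=
  M.flatMap fun m => [(m.1 : ℕ), (m.2 : ℕ)]

/-- The correct answers: `0` if `P` and `Q` are not reconfigurable; otherwise `1`, followed by the
moves of a reconfiguration of `P` to `Q`. -/
def IsAnswer {n : ℕ} (G : SimpleGraph (Fin n)) (s t : Fin n) {ℓ : ℕ}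
    (P Q : Fin (ℓ + 1) → Fin n) (out : List ℕ) : Prop :=
  (¬ Reconfigurable G s t P Q ∧ out = [0]) ∨
  (Reconfigurable G s t P Q ∧
    ∃ M : List (Fin (ℓ + 1) × Fin n), IsReconfiguration G s t Q P M ∧ out = 1 :: encodeMoves M)

/-- SPR, restricted to graphs in the class `𝒢`, can be solved in time `O(f n)`, where `n` is the
number of vertices: one program, on a machine whose words hold numbers of size polynomial in `n`
(that is, words of `O(log n)` bits), solves every instance. -/
def SolvableInTime (𝒢 : ∀ {n : ℕ}, SimpleGraph (Fin n) → Prop) (f : ℕ → ℕ) : Prop :=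
  ∃ (p : Prog) (C d : ℕ), ∀ (n : ℕ) (G : SimpleGraph (Fin n)), 𝒢 G →
    ∀ (s t : Fin n) (ℓ : ℕ) (P Q : Fin (ℓ + 1) → Fin n),
      IsShortestPath G s t P → IsShortestPath G s t Q →
      ∃ (τ : ℕ) (σ : State), Exec (C * n ^ d) p (initState (encodeInstance G s t P Q)) τ σ ∧
        τ ≤ C * f n ∧ IsAnswer G s t P Q σ.out

end SPR

namespace SPR

open Classical

/-! ### Balls and distances -/

section Graphs

variable {V : Type*} {G : SimpleGraph V}

/-! In a weakly modular graph any two shortest `s`–`t` paths are reconfigurable, so the answer is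
always positive and only a sequence has to be found. Let the current path `p` agree with the target
`q` from position `j + 1` on, and put `x j = q j`. If `x i` is at distance `i ≥ 1` from `s` and
adjacent to `p (i + 1)`, the quadrangle condition, applied at `s` to `p i` and `x i` with common
neighbour `p (i + 1)`, yields a vertex `x (i - 1)` at distance `i - 1` adjacent to both. The descent
ends at `x 0 = s` (`runs_descend`). Since every `x i` is adjacent to `p (i + 1)`, following `x`
before position `i` and `p` from there on is a shortest path for every `i ≤ j + 1`
(`IsShortestPath.splice`). Replacing vertices one at a time from `s` onwards (`runs_moveAll`) thus
makes the path agree with `q` from position `j` on, and `runs_fixAll` repeats this for decreasing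
`j`.

Breadth-first search from `s` stores the distance layers consecutively in `O(n^2)` time
(`runs_bfs`). Finding `x (i - 1)` takes time linear in the size of its layer; the layers are
disjoint, so a descent costs `O(n)`, and there are `ℓ < n` descents.

In a bridged graph balls are convex, because they arise from a point by taking neighbourhoods. This
gives the triangle condition (`Bridged.triangle`), and makes the quadrangle condition impossible to
violate: two nonadjacent vertices of a ball have no common neighbour outside it. -/

/-- The vertices at distance less than `k` from `s`. -/
def walkBall (G : SimpleGraph V) (s : V) (k : ℕ) : Set V :=
  {v | ∃ w : G.Walk s v, w.length < k}

theorem mem_walkBall_iff {s v : V} {k : ℕ} :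
    v ∈ walkBall G s k ↔ G.Reachable s v ∧ G.dist s v < k := by
  constructor
  · rintro ⟨w, hw⟩
    exact ⟨w.reachable, (SimpleGraph.dist_le w).trans_lt hw⟩
  · rintro ⟨hr, hd⟩
    obtain ⟨w, hw⟩ := hr.exists_walk_length_eq_dist
    exact ⟨w, by omega⟩

theorem walkBall_zero (s : V) : walkBall G s 0 = ∅ := by
  ext v; simp [walkBall]

theorem walkBall_one (s : V) : walkBall G s 1 = {s} := by
  ext v
  simp only [walkBall, Set.mem_ofPred_eq, Set.mem_singleton_iff]
  constructor
  · rintro ⟨w, hw⟩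
    exact (SimpleGraph.Walk.eq_of_length_eq_zero (p := w) (by omega)).symm
  · rintro rfl
    exact ⟨SimpleGraph.Walk.nil, by simp⟩

theorem exists_adj_walk {s v : V} (w : G.Walk s v) {k : ℕ} (hk : w.length = k + 1) :
    ∃ u, G.Adj u v ∧ ∃ w' : G.Walk s u, w'.length = k := by
  have h := w.length_reverse
  cases hw : w.reverse with
  | nil => rw [hw] at h; simp at h; omega
  | cons hadj q =>
    rw [hw] at h
    exact ⟨_, hadj.symm, q.reverse, by simp at h ⊢; omega⟩

/-- The shift by one excludes the empty ball, whose neighbourhood is empty and not `{s}`. -/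
theorem walkBall_succ (s : V) (k : ℕ) :
    walkBall G s (k + 2) = nbhd G (walkBall G s (k + 1)) := by
  ext v
  simp only [walkBall, nbhd, Set.mem_ofPred_eq]
  constructor
  · rintro ⟨w, hw⟩
    by_cases h : w.length < k + 1
    · exact Or.inl ⟨w, h⟩
    · obtain ⟨u, hu, w', hw'⟩ := exists_adj_walk w (k := k) (by omega)
      exact Or.inr ⟨u, ⟨w', by omega⟩, hu⟩
  · rintro (⟨w, hw⟩ | ⟨u, ⟨w, hw⟩, hu⟩)
    · exact ⟨w, by omega⟩
    · exact ⟨w.concat hu, by simp; omega⟩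

theorem dist_le_succ_of_adj {u v w : V} (h : G.Adj v w) (hr : G.Reachable u v) :
    G.dist u w ≤ G.dist u v + 1 := by
  have := hr.dist_triangle_left w
  rwa [SimpleGraph.dist_eq_one_iff_adj.mpr h] at this

theorem exists_adj_dist_eq {u v : V} {k : ℕ} (h : G.dist u v = k + 1) :
    ∃ x, G.Adj x v ∧ G.Reachable u x ∧ G.dist u x = k := by
  have hr : G.Reachable u v := SimpleGraph.Reachable.of_dist_ne_zero (by omega)
  obtain ⟨w, hw⟩ := hr.exists_walk_length_eq_dist
  obtain ⟨x, hx, w', hw'⟩ := exists_adj_walk w (k := k) (by omega)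
  refine ⟨x, hx, w'.reachable, ?_⟩
  have h1 := SimpleGraph.dist_le w'
  have h2 := dist_le_succ_of_adj hx w'.reachable
  omega

/-! ### Bridged graphs are weakly modular -/

theorem isConvex_singleton (a : V) : IsConvex G {a} := by
  rintro u rfl v rfl w ⟨h1, -, h3⟩
  rw [SimpleGraph.dist_self] at h3
  exact (h1.dist_eq_zero_iff.mp (by omega)).symm

theorem isConvex_pair {a b : V} (hab : G.Adj a b) : IsConvex G {a, b} := by
  have key : ∀ x y w : V, G.dist x y ≤ 1 → w ∈ interval G x y → w = x ∨ w = y := by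
    rintro x y w hd ⟨h1, h2, h3⟩
    by_cases h : G.dist x w = 0
    · exact Or.inl (h1.dist_eq_zero_iff.mp h).symm
    · exact Or.inr (h2.dist_eq_zero_iff.mp (by omega))
  have h1 := SimpleGraph.dist_eq_one_iff_adj.mpr hab
  have h2 := SimpleGraph.dist_eq_one_iff_adj.mpr hab.symm
  rintro u (rfl | rfl) v (rfl | rfl) w hw
  all_goals
    have := key _ _ w (by simp [*]) hw
    simp only [Set.mem_insert_iff, Set.mem_singleton_iff]
    tauto

/-- The middle vertex of an induced path with two edges lies on a geodesic. Most uses of convexity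
below take this form. -/
theorem IsConvex.mem_of_adj {H : Set V} (hH : IsConvex G H) {a b c : V} (ha : a ∈ H) (hc : c ∈ H)
    (hab : G.Adj a b) (hbc : G.Adj b c) (hac : ¬ G.Adj a c) (hne : a ≠ c) : b ∈ H := by
  refine hH a ha c hc ⟨hab.reachable, hbc.reachable, ?_⟩
  have h1 := (hab.reachable.trans hbc.reachable).one_lt_dist_of_ne_of_not_adj hne hac
  have h2 := dist_le_succ_of_adj hbc hab.reachable
  rw [SimpleGraph.dist_eq_one_iff_adj.mpr hab] at h2 ⊢
  rw [SimpleGraph.dist_eq_one_iff_adj.mpr hbc]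
  omega

theorem Bridged.isConvex_walkBall (hG : Bridged G) (u : V) : ∀ k, IsConvex G (walkBall G u k)
  | 0 => by rw [walkBall_zero]; exact fun _ h => h.elim
  | 1 => by rw [walkBall_one]; exact isConvex_singleton u
  | k + 2 => by rw [walkBall_succ]; exact hG _ (hG.isConvex_walkBall u (k + 1))

/-- There are no induced 4-cycles: if `b`, `d` are not adjacent, convexity of `N[a]` puts `c` into
`N[a]`. -/
theorem Bridged.adj_or_adj_of_square (hG : Bridged G) {a b c d : V} (hab : G.Adj a b)
    (hbc : G.Adj b c) (hcd : G.Adj c d) (hda : G.Adj d a) (hac : a ≠ c) (hbd : b ≠ d) :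
    G.Adj a c ∨ G.Adj b d := by
  by_contra! h
  have := (hG _ (isConvex_singleton a)).mem_of_adj (Or.inr ⟨a, rfl, hab⟩)
    (Or.inr ⟨a, rfl, hda.symm⟩) hbc hcd h.2 hbd
  rcases this with h' | ⟨x, rfl, hx⟩
  · exact hac h'.symm
  · exact h.1 hx

/-- Choose neighbours `v'`, `w'` of `v`, `w` one layer down. If neither is adjacent to both `v` and
`w`, they are distinct and, by the absence of induced 4-cycles, not adjacent. A common neighbour `y`
of `v'` and `w'` then turns out to be the required vertex; without one, `v` lies on a geodesic
between `v'` and `w'`, against convexity of the ball. -/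
theorem Bridged.triangle (hG : Bridged G) {k : ℕ} {u v w : V} (hv : G.dist u v = k + 1)
    (hw : G.dist u w = k + 1) (hvw : G.Adj v w) : ∃ x, G.dist u x = k ∧ G.Adj x v ∧ G.Adj x w := by
  obtain ⟨v', hv'v, hrv, hdv⟩ := exists_adj_dist_eq hv
  obtain ⟨w', hw'w, hrw, hdw⟩ := exists_adj_dist_eq hw
  have hB := hG.isConvex_walkBall u (k + 1)
  have mv : v' ∈ walkBall G u (k + 1) := mem_walkBall_iff.mpr ⟨hrv, by omega⟩
  have mw : w' ∈ walkBall G u (k + 1) := mem_walkBall_iff.mpr ⟨hrw, by omega⟩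
  have nv : v ∉ walkBall G u (k + 1) := fun h => by have := (mem_walkBall_iff.mp h).2; omega
  have nw : w ∉ walkBall G u (k + 1) := fun h => by have := (mem_walkBall_iff.mp h).2; omega
  by_cases h1 : G.Adj w' v
  · exact ⟨w', hdw, h1, hw'w⟩
  by_cases h2 : G.Adj v' w
  · exact ⟨v', hdv, hv'v, h2⟩
  have hne : v' ≠ w' := by rintro rfl; exact h1 hv'v
  have nvw' : v ≠ w' := by rintro rfl; exact nv mw
  have nwv' : w ≠ v' := by rintro rfl; exact nw mv
  have h3 : ¬ G.Adj v' w' := fun h => by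
    rcases hG.adj_or_adj_of_square hv'v.symm h hw'w hvw.symm nvw' nwv'.symm with h | h
    · exact h1 h.symm
    · exact h2 h
  by_cases h4 : ∃ y, G.Adj v' y ∧ G.Adj y w'
  · obtain ⟨y, hy1, hy2⟩ := h4
    have my := hB.mem_of_adj mv mw hy1 hy2 h3 hne
    -- The neighbourhood of the edge `v'y` contains `v` and `w'`, hence their common neighbour `w`;
    -- as `w` is not adjacent to `v'`, it is adjacent to `y`.
    have := (hG _ (isConvex_pair hy1)).mem_of_adj (Or.inr ⟨v', by simp, hv'v⟩)
      (Or.inr ⟨y, by simp, hy2⟩) hvw hw'w.symm (fun h => h1 h.symm) nvw'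
    have hyw : G.Adj y w := by
      rcases this with (h | h) | ⟨x, h | h, hx⟩
      · exact (nwv' h).elim
      · rw [Set.mem_singleton_iff] at h; subst h; exact (nw my).elim
      · subst h; exact (h2 hx).elim
      · rw [Set.mem_singleton_iff] at h; subst h; exact hx
    have nvy : v ≠ y := by rintro rfl; exact nv my
    have hyv : G.Adj v y := by
      rcases hG.adj_or_adj_of_square hv'v.symm hy1 hyw hvw.symm nvy nwv'.symm with h | h
      · exact h
      · exact (h2 h).elim
    have hy := mem_walkBall_iff.mp my
    have := dist_le_succ_of_adj hyv.symm hy.1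
    exact ⟨y, by omega, hyv.symm, hyw⟩
  -- Now `v'` and `w'` are at distance at least 3, so the walk `v', v, w, w'` is a geodesic.
  · have r1 : G.Reachable v w' := hvw.reachable.trans hw'w.symm.reachable
    have hr : G.Reachable v' w' := hv'v.reachable.trans r1
    have d1 := SimpleGraph.dist_eq_one_iff_adj.mpr hv'v
    have d2 := dist_le_succ_of_adj hw'w.symm hvw.reachable
    rw [SimpleGraph.dist_eq_one_iff_adj.mpr hvw] at d2
    have d3 := hr.one_lt_dist_of_ne_of_not_adj hne h3
    have d4 : G.dist v' w' ≠ 2 := fun h => by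
      obtain ⟨y, hy, hry, hdy⟩ := exists_adj_dist_eq (k := 1) h
      exact h4 ⟨y, SimpleGraph.dist_eq_one_iff_adj.mp hdy, hy⟩
    have d5 := hv'v.reachable.dist_triangle_left w'
    exact (nv (hB v' mv w' mw ⟨hv'v.reachable, r1, by omega⟩)).elim

theorem Bridged.weaklyModular (hG : Bridged G) : WeaklyModular G where
  triangle _ _ _ _ hv hw hvw := hG.triangle hv hw hvw
  quadrangle k u v w z hv hw hz hvz hwz := by
    by_cases hne : v = w
    · subst hne
      obtain ⟨x, hx, -, hd⟩ := exists_adj_dist_eq hv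
      exact ⟨x, hd, hx, hx⟩
    · by_cases hadj : G.Adj v w
      · exact hG.triangle hv hw hadj
      · have hrv : G.Reachable u v := SimpleGraph.Reachable.of_dist_ne_zero (by omega)
        have hrw : G.Reachable u w := SimpleGraph.Reachable.of_dist_ne_zero (by omega)
        have := (hG.isConvex_walkBall u (k + 2)).mem_of_adj (mem_walkBall_iff.mpr ⟨hrv, by omega⟩)
          (mem_walkBall_iff.mpr ⟨hrw, by omega⟩) hvz hwz.symm hadj hne
        have := (mem_walkBall_iff.mp this).2
        omega

/-! ### Shortest paths and their reconfiguration -/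

variable {s t : V} {ℓ : ℕ}

/-- Paths are treated as restrictions of infinite sequences, which avoids arithmetic in `Fin`;
values beyond `ℓ` play no role. -/
theorem walk_of_adj {p : ℕ → V} (h : ∀ i < ℓ, G.Adj (p i) (p (i + 1))) :
    ∀ (d i : ℕ), i + d ≤ ℓ → ∃ w : G.Walk (p i) (p (i + d)), w.length = d
  | 0, _, _ => ⟨SimpleGraph.Walk.nil, rfl⟩
  | d + 1, i, hi => by
    obtain ⟨w, hw⟩ := walk_of_adj h d i (by omega)
    exact ⟨w.concat (h (i + d) (by omega)), by simp [hw]⟩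

/-- The two parts of the path bound the two distances from above, and the triangle inequality forces
equality. -/
theorem dist_of_shortest {p : ℕ → V} (h : ∀ i < ℓ, G.Adj (p i) (p (i + 1)))
    (hℓ : ℓ = G.dist (p 0) (p ℓ)) {i : ℕ} (hi : i ≤ ℓ) :
    G.Reachable (p 0) (p i) ∧ G.dist (p 0) (p i) = i := by
  obtain ⟨d, rfl⟩ := Nat.exists_eq_add_of_le hi
  obtain ⟨w₁, h₁⟩ : ∃ w : G.Walk (p 0) (p i), w.length = i := by
    have := walk_of_adj h i 0 (by omega)
    rwa [Nat.zero_add] at this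
  obtain ⟨w₂, h₂⟩ := walk_of_adj h d i le_rfl
  have h3 := SimpleGraph.dist_le w₁
  have h4 := SimpleGraph.dist_le w₂
  have h5 := w₁.reachable.dist_triangle_left (p (i + d))
  exact ⟨w₁.reachable, by omega⟩

theorem restrict_update (p : ℕ → V) {i : ℕ} (hi : i < ℓ + 1) (v : V) :
    (fun j : Fin (ℓ + 1) => Function.update p i v j) =
      Function.update (fun j : Fin (ℓ + 1) => p j) ⟨i, hi⟩ v := by
  ext j
  simp [Function.update_apply, Fin.ext_iff]

theorem isShortestPath_restrict_iff {p : ℕ → V} :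
    IsShortestPath G s t (fun i : Fin (ℓ + 1) => p i) ↔
      p 0 = s ∧ p ℓ = t ∧ (∀ i < ℓ, G.Adj (p i) (p (i + 1))) ∧ ℓ = G.dist s t := by
  constructor
  · rintro ⟨h1, h2, h3, h4⟩
    exact ⟨by simpa using h1, by simpa using h2, fun i hi => by simpa using h3 ⟨i, hi⟩, h4⟩
  · rintro ⟨h1, h2, h3, h4⟩
    exact ⟨by simpa using h1, by simpa using h2, fun i => by simpa using h3 i i.2, h4⟩

/-- The sequence that follows `x` before position `i` and `p` from there on. -/
def splice (x p : ℕ → V) (i : ℕ) : ℕ → V := fun m => if m < i then x m else p m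

theorem splice_zero (x p : ℕ → V) : splice x p 0 = p := by
  ext m; simp [splice]

theorem splice_succ (x p : ℕ → V) (i : ℕ) :
    splice x p (i + 1) = Function.update (splice x p i) i (x i) := by
  ext m
  simp only [splice, Function.update_apply]
  split_ifs <;> first | rfl | omega | simp_all

/-- The only edge belonging to neither sequence is the junction from `x (i - 1)` to `p i`, provided
by `hxp`. -/
theorem IsShortestPath.splice {p x : ℕ → V} {j : ℕ}
    (hp : IsShortestPath G s t (fun i : Fin (ℓ + 1) => p i)) (hj : j < ℓ) (hx0 : x 0 = s)
    (hx : ∀ i < j, G.Adj (x i) (x (i + 1))) (hxp : ∀ i ≤ j, G.Adj (x i) (p (i + 1))) {i : ℕ}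
    (hi : i ≤ j + 1) :
    IsShortestPath G s t (fun m : Fin (ℓ + 1) => SPR.splice x p i m) := by
  obtain ⟨h1, h2, h3, h4⟩ := isShortestPath_restrict_iff.mp hp
  refine isShortestPath_restrict_iff.mpr ⟨?_, ?_, fun m hm => ?_, h4⟩ <;> unfold SPR.splice
  · split_ifs <;> assumption
  · rw [if_neg (by omega), h2]
  · by_cases h : m + 1 < i
    · rw [if_pos h, if_pos (by omega)]
      exact hx m (by omega)
    · rw [if_neg h]
      split_ifs
      · exact hxp m (by omega)
      · exact h3 m hm

/-- The machine outputs moves in order, so sequences grow at the end, whereas `IsReconfiguration`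
recurses from the front. -/
theorem IsReconfiguration.concat [DecidableEq V] {P R : Fin (ℓ + 1) → V} {M : List (Fin (ℓ + 1) × V)}
    {i : Fin (ℓ + 1)} {v : V} (h : IsReconfiguration G s t R P M) (hv : v ≠ R i)
    (hR : IsShortestPath G s t (Function.update R i v)) :
    IsReconfiguration G s t (Function.update R i v) P (M ++ [(i, v)]) := by
  induction M generalizing P with
  | nil =>
    obtain ⟨h1, rfl⟩ := h
    exact ⟨h1, hv, hR, rfl⟩
  | cons m M ih => exact ⟨h.1, h.2.1, ih h.2.2⟩

theorem IsReconfiguration.reconfigurable {P Q : Fin (ℓ + 1) → V} {M : List (Fin (ℓ + 1) × V)}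
    (h : IsReconfiguration G s t Q P M) : Reconfigurable G s t P Q := by
  induction M generalizing P with
  | nil =>
    obtain ⟨h1, rfl⟩ := h
    exact ⟨0, fun _ => P, rfl, rfl, fun _ => h1, fun j => j.elim0⟩
  | cons m M ih =>
    obtain ⟨i, v⟩ := m
    obtain ⟨h1, h2, h3⟩ := h
    obtain ⟨k, R, hR0, hRk, hR, hstep⟩ := ih h3
    refine ⟨k + 1, Fin.cons P R, rfl, ?_, ?_, ?_⟩
    · rw [← Fin.succ_last, Fin.cons_succ, hRk]
    · intro j
      refine Fin.cases ?_ (fun j => ?_) j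
      · exact h1
      · exact hR j
    · intro j
      refine Fin.cases ?_ (fun j => ?_) j
      · refine ⟨i, ?_, ?_⟩
        · simpa [hR0] using h2.symm
        · intro i' hi'
          by_contra hne
          exact hi' (by simp [hR0, hne])
      · simpa using hstep j

end Graphs

/-! ### Running programs with a time budget -/

/-- Within `T` steps the program `p`, started in `σ`, halts in a state `σ'` with `Q T' σ'`, where
`T'` is the unused part of the budget `T`. -/
def Runs (W : ℕ) (p : Prog) (T : ℕ) (σ : State) (Q : ℕ → State → Prop) : Prop :=
  ∃ τ σ', Exec W p σ τ σ' ∧ τ ≤ T ∧ Q (T - τ) σ'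

section Runs

variable {W T : ℕ} {ρ m : ℕ → ℕ} {o : List ℕ} {σ : State} {Q : ℕ → State → Prop} {p q : Prog}

theorem Runs.mono {Q' : ℕ → State → Prop} (h : Runs W p T σ Q)
    (hQ : ∀ T' σ', T' ≤ T → Q T' σ' → Q' T' σ') : Runs W p T σ Q' := by
  obtain ⟨τ, σ', h1, h2, h3⟩ := h
  exact ⟨τ, σ', h1, h2, hQ _ _ (by omega) h3⟩

theorem runs_skip : Runs W .skip T σ Q ↔ Q T σ := by
  constructor
  · rintro ⟨τ, σ', h1, h2, h3⟩
    cases h1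
    exact h3
  · intro h
    exact ⟨0, σ, .skip σ, by omega, h⟩

theorem runs_instr {c : Instr} :
    Runs W (.instr c) T σ Q ↔ 1 ≤ T ∧ ∃ σ', c.run W σ = some σ' ∧ Q (T - 1) σ' := by
  constructor
  · rintro ⟨τ, σ', h1, h2, h3⟩
    cases h1 with
    | instr _ _ _ h => exact ⟨h2, σ', h, h3⟩
  · rintro ⟨hT, σ', h1, h2⟩
    exact ⟨1, σ', .instr _ _ _ h1, hT, h2⟩

/-- The second program inherits the unused budget. Used as rewriting rules, this and its companions
reduce a straight-line program to a list of arithmetic side conditions. -/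
theorem runs_seq :
    Runs W (.seq p q) T σ Q ↔ Runs W p T σ fun T' σ' => Runs W q T' σ' Q := by
  constructor
  · rintro ⟨τ, σ', h1, h2, h3⟩
    cases h1 with
    | seq _ _ _ σ₁ _ τ₁ τ₂ h₁ h₂ =>
      exact ⟨τ₁, σ₁, h₁, by omega, τ₂, σ', h₂, by omega, by rwa [Nat.sub_sub]⟩
  · rintro ⟨τ₁, σ₁, h₁, hT₁, τ₂, σ', h₂, hT₂, h⟩
    exact ⟨τ₁ + τ₂, σ', .seq _ _ _ _ _ _ _ h₁ h₂, by omega, by rwa [← Nat.sub_sub]⟩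

theorem runs_cond {b : Test} :
    Runs W (.cond b p q) T σ Q ↔
      1 ≤ T ∧ (b.Holds σ → Runs W p (T - 1) σ Q) ∧ (¬ b.Holds σ → Runs W q (T - 1) σ Q) := by
  constructor
  · rintro ⟨τ, σ', h1, h2, h3⟩
    cases h1 with
    | condTrue _ _ _ _ _ τ hb h =>
      exact ⟨by omega, fun _ => ⟨τ, σ', h, by omega, by rwa [Nat.sub_sub, add_comm]⟩,
        fun hn => (hn hb).elim⟩
    | condFalse _ _ _ _ _ τ hb h =>
      exact ⟨by omega, fun hn => (hb hn).elim,
        fun _ => ⟨τ, σ', h, by omega, by rwa [Nat.sub_sub, add_comm]⟩⟩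
  · rintro ⟨hT, h1, h2⟩
    by_cases hb : b.Holds σ
    · obtain ⟨τ, σ', h, hτ, hQ⟩ := h1 hb
      exact ⟨τ + 1, σ', .condTrue _ _ _ _ _ _ hb h, by omega, by rwa [add_comm, ← Nat.sub_sub]⟩
    · obtain ⟨τ, σ', h, hτ, hQ⟩ := h2 hb
      exact ⟨τ + 1, σ', .condFalse _ _ _ _ _ _ hb h, by omega, by rwa [add_comm, ← Nat.sub_sub]⟩

/-- The invariant may mention the remaining budget. Termination needs no separate measure: each
iteration spends at least the step for the test, so induction on the budget suffices. -/
theorem runs_loop {b : Test} (I : ℕ → State → Prop)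
    (hI : ∀ T σ, I T σ → 1 ≤ T ∧ (b.Holds σ → Runs W p (T - 1) σ I) ∧ (¬ b.Holds σ → Q (T - 1) σ))
    (h : I T σ) : Runs W (.loop b p) T σ Q := by
  induction T using Nat.strong_induction_on generalizing σ with
  | _ T ih =>
    obtain ⟨hT, h1, h2⟩ := hI T σ h
    by_cases hb : b.Holds σ
    · obtain ⟨τ₁, σ₁, he, hτ, hI'⟩ := h1 hb
      obtain ⟨τ₂, σ₂, he₂, hτ₂, hQ⟩ := ih _ (by omega) hI'
      refine ⟨τ₁ + τ₂ + 1, σ₂, .loopStep _ _ _ _ _ _ _ hb he he₂, by omega, ?_⟩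
      rwa [show T - (τ₁ + τ₂ + 1) = T - 1 - τ₁ - τ₂ by omega]
    · exact ⟨1, σ, .loopStop _ _ _ hb, hT, h2 hb⟩

theorem runs_assign {d x : ℕ} {c : Instr} (hc : c.run W ⟨ρ, m, o⟩ = State.assign W ⟨ρ, m, o⟩ d x) :
    Runs W (.instr c) T ⟨ρ, m, o⟩ Q ↔ 1 ≤ T ∧ x < W ∧ Q (T - 1) ⟨Function.update ρ d x, m, o⟩ := by
  rw [runs_instr, hc]
  unfold State.assign
  split_ifs with h <;> simp [h]

theorem runs_const {r k : ℕ} : Runs W (.instr (.const r k)) T ⟨ρ, m, o⟩ Q ↔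
    1 ≤ T ∧ k < W ∧ Q (T - 1) ⟨Function.update ρ r k, m, o⟩ := runs_assign rfl

theorem runs_move {r a : ℕ} : Runs W (.instr (.move r a)) T ⟨ρ, m, o⟩ Q ↔
    1 ≤ T ∧ ρ a < W ∧ Q (T - 1) ⟨Function.update ρ r (ρ a), m, o⟩ := runs_assign rfl

theorem runs_add {r a b : ℕ} : Runs W (.instr (.add r a b)) T ⟨ρ, m, o⟩ Q ↔
    1 ≤ T ∧ ρ a + ρ b < W ∧ Q (T - 1) ⟨Function.update ρ r (ρ a + ρ b), m, o⟩ := runs_assign rfl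

theorem runs_sub {r a b : ℕ} : Runs W (.instr (.sub r a b)) T ⟨ρ, m, o⟩ Q ↔
    1 ≤ T ∧ ρ a - ρ b < W ∧ Q (T - 1) ⟨Function.update ρ r (ρ a - ρ b), m, o⟩ := runs_assign rfl

theorem runs_mul {r a b : ℕ} : Runs W (.instr (.mul r a b)) T ⟨ρ, m, o⟩ Q ↔
    1 ≤ T ∧ ρ a * ρ b < W ∧ Q (T - 1) ⟨Function.update ρ r (ρ a * ρ b), m, o⟩ := runs_assign rfl

theorem runs_load {r a : ℕ} : Runs W (.instr (.load r a)) T ⟨ρ, m, o⟩ Q ↔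
    1 ≤ T ∧ m (ρ a) < W ∧ Q (T - 1) ⟨Function.update ρ r (m (ρ a)), m, o⟩ := runs_assign rfl

theorem runs_store {a b : ℕ} : Runs W (.instr (.store a b)) T ⟨ρ, m, o⟩ Q ↔
    1 ≤ T ∧ Q (T - 1) ⟨ρ, Function.update m (ρ a) (ρ b), o⟩ := by
  rw [runs_instr]; simp [Instr.run]

theorem runs_print {a : ℕ} : Runs W (.instr (.print a)) T ⟨ρ, m, o⟩ Q ↔
    1 ≤ T ∧ Q (T - 1) ⟨ρ, m, o ++ [ρ a]⟩ := by
  rw [runs_instr]; simp [Instr.run]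

/-- Sequential composition of a list of programs. -/
def block : List Prog → Prog
  | [] => .skip
  | p :: l => .seq p (block l)

theorem runs_block_nil : Runs W (block []) T σ Q ↔ Q T σ := runs_skip

theorem runs_block_cons {l : List Prog} :
    Runs W (block (p :: l)) T σ Q ↔ Runs W p T σ fun T' σ' => Runs W (block l) T' σ' Q := runs_seq

/-- `d := mem[b + i]` -/
def loadAt (d b i : ℕ) : Prog := .seq (.instr (.add d b i)) (.instr (.load d d))

/-- `mem[b + i] := v`, with the auxiliary register `d` -/
def storeAt (d b i v : ℕ) : Prog := .seq (.instr (.add d b i)) (.instr (.store d v))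

theorem runs_loadAt {d b i : ℕ} : Runs W (loadAt d b i) T ⟨ρ, m, o⟩ Q ↔
    2 ≤ T ∧ ρ b + ρ i < W ∧ m (ρ b + ρ i) < W ∧
      Q (T - 2) ⟨Function.update ρ d (m (ρ b + ρ i)), m, o⟩ := by
  simp only [loadAt, runs_seq, runs_add, runs_load, Function.update_self, Function.update_idem,
    Nat.sub_sub]
  constructor
  · rintro ⟨h1, h2, h3, h4, h5⟩
    exact ⟨by omega, h2, h4, h5⟩
  · rintro ⟨h1, h2, h3, h4⟩
    exact ⟨by omega, h2, by omega, h3, h4⟩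

/-- Register `d` receives the address before `v` is read, hence `v ≠ d`. -/
theorem runs_storeAt {d b i v : ℕ} (hv : v ≠ d) : Runs W (storeAt d b i v) T ⟨ρ, m, o⟩ Q ↔
    2 ≤ T ∧ ρ b + ρ i < W ∧
      Q (T - 2) ⟨Function.update ρ d (ρ b + ρ i), Function.update m (ρ b + ρ i) (ρ v), o⟩ := by
  simp only [storeAt, runs_seq, runs_add, runs_store, Function.update_self,
    Function.update_of_ne hv, Nat.sub_sub]
  constructor
  · rintro ⟨h1, h2, h3, h4⟩
    exact ⟨by omega, h2, h4⟩
  · rintro ⟨h1, h2, h3⟩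
    exact ⟨by omega, h2, by omega, h3⟩

end Runs

/-! ### The contents of registers and memory -/

/-- The matrix follows four parameters and two paths with `ℓ + 1` vertices each. The input ends at
`queBase`; the four working arrays after it have `n` cells each. -/
def adjBase (ℓ : ℕ) : ℕ := 6 + 2 * ℓ
def queBase (n ℓ : ℕ) : ℕ := adjBase ℓ + n * n
def visBase (n ℓ : ℕ) : ℕ := queBase n ℓ + n
def startBase (n ℓ : ℕ) : ℕ := visBase n ℓ + n
def auxBase (n ℓ : ℕ) : ℕ := startBase n ℓ + n

/-- The registers `0, …, 10` hold the constants used throughout: two numbers, the parameters of the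
instance and the addresses of the arrays. -/
structure Consts (n ℓ : ℕ) (ρ : ℕ → ℕ) : Prop where
  zero : ρ 0 = 0
  one : ρ 1 = 1
  num : ρ 2 = n
  len : ρ 3 = ℓ
  cur : ρ 4 = 4
  tgt : ρ 5 = 5 + ℓ
  adj : ρ 6 = adjBase ℓ
  que : ρ 7 = queBase n ℓ
  vis : ρ 8 = visBase n ℓ
  start : ρ 9 = startBase n ℓ
  aux : ρ 10 = auxBase n ℓ

theorem Consts.congr {n ℓ : ℕ} {ρ ρ' : ℕ → ℕ} (h : Consts n ℓ ρ) (he : ∀ r < 11, ρ' r = ρ r) :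
    Consts n ℓ ρ' := by
  constructor <;> rw [he _ (by omega)]
  exacts [h.zero, h.one, h.num, h.len, h.cur, h.tgt, h.adj, h.que, h.vis, h.start, h.aux]

theorem row_lt {n : ℕ} (u v : Fin n) : n * u + v < n * n := by
  have h1 : n * (u + 1) ≤ n * n := Nat.mul_le_mul_left n u.2
  have h2 := v.2
  rw [Nat.mul_add] at h1
  omega

/-- The arrays stored in the memory: the current path `cur`, the target path `tgt`, the adjacency
matrix, a queue `que` of vertices, a set `S` of visited vertices, the array `st` of starting points
of layers in the queue, and an auxiliary array `aux` of vertices. -/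
structure Arrays {n : ℕ} (G : SimpleGraph (Fin n)) (ℓ : ℕ) (cur tgt que : ℕ → Fin n)
    (S : Set (Fin n)) (st : ℕ → ℕ) (aux : ℕ → Fin n) (m : ℕ → ℕ) : Prop where
  cur : ∀ i ≤ ℓ, m (4 + i) = cur i
  tgt : ∀ i ≤ ℓ, m (5 + ℓ + i) = tgt i
  adj : ∀ u v : Fin n, m (adjBase ℓ + (n * u + v)) = if G.Adj u v then 1 else 0
  que : ∀ i < n, m (queBase n ℓ + i) = que i
  vis : ∀ v : Fin n, m (visBase n ℓ + v) = if v ∈ S then 1 else 0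
  start : ∀ i < n, m (startBase n ℓ + i) = st i
  aux : ∀ i < n, m (auxBase n ℓ + i) = aux i

/-! ### Writing to one array leaves the others intact -/

namespace Arrays

variable {n : ℕ} {G : SimpleGraph (Fin n)} {ℓ : ℕ} {cur tgt que : ℕ → Fin n}
    {S : Set (Fin n)} {st : ℕ → ℕ} {aux : ℕ → Fin n} {m : ℕ → ℕ}

theorem update_cur (h : Arrays G ℓ cur tgt que S st aux m) {i : ℕ} (hi : i ≤ ℓ) (v : Fin n) :
    Arrays G ℓ (Function.update cur i v) tgt que S st aux (Function.update m (4 + i) v) where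
  cur j hj := by
    simp only [Function.update_apply, Nat.add_left_cancel_iff]
    split_ifs <;> simp [h.cur j hj]
  tgt j hj := by rw [Function.update_of_ne (by omega), h.tgt j hj]
  adj u w := by
    rw [Function.update_of_ne (by simp only [adjBase]; omega), h.adj u w]
  que j hj := by
    rw [Function.update_of_ne (by simp only [queBase, adjBase]; omega), h.que j hj]
  vis w := by
    rw [Function.update_of_ne (by simp only [visBase, queBase, adjBase]; omega), h.vis w]
  start j hj := by
    rw [Function.update_of_ne (by simp only [startBase, visBase, queBase, adjBase]; omega),
      h.start j hj]
  aux j hj := by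
    rw [Function.update_of_ne (by simp only [auxBase, startBase, visBase, queBase, adjBase]; omega),
      h.aux j hj]

theorem update_que (h : Arrays G ℓ cur tgt que S st aux m) {i : ℕ} (hi : i < n) (v : Fin n) :
    Arrays G ℓ cur tgt (Function.update que i v) S st aux
      (Function.update m (queBase n ℓ + i) v) where
  cur j hj := by
    rw [Function.update_of_ne (by simp only [queBase, adjBase]; omega), h.cur j hj]
  tgt j hj := by
    rw [Function.update_of_ne (by simp only [queBase, adjBase]; omega), h.tgt j hj]
  adj u w := by
    have := row_lt u w
    rw [Function.update_of_ne (by simp only [queBase]; omega), h.adj u w]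
  que j hj := by
    simp only [Function.update_apply, Nat.add_left_cancel_iff]
    split_ifs <;> simp [h.que j hj]
  vis w := by
    rw [Function.update_of_ne (by simp only [visBase]; omega), h.vis w]
  start j hj := by
    rw [Function.update_of_ne (by simp only [startBase, visBase]; omega), h.start j hj]
  aux j hj := by
    rw [Function.update_of_ne (by simp only [auxBase, startBase, visBase]; omega), h.aux j hj]

theorem insert_vis (h : Arrays G ℓ cur tgt que S st aux m) (v : Fin n) :
    Arrays G ℓ cur tgt que (insert v S) st aux (Function.update m (visBase n ℓ + v) 1) where
  cur j hj := by
    rw [Function.update_of_ne (by simp only [visBase, queBase, adjBase]; omega), h.cur j hj]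
  tgt j hj := by
    rw [Function.update_of_ne (by simp only [visBase, queBase, adjBase]; omega), h.tgt j hj]
  adj u w := by
    have := row_lt u w
    rw [Function.update_of_ne (by simp only [visBase, queBase]; omega), h.adj u w]
  que j hj := by
    rw [Function.update_of_ne (by simp only [visBase]; omega), h.que j hj]
  vis w := by
    simp only [Function.update_apply, Nat.add_left_cancel_iff, Set.mem_insert_iff, Fin.ext_iff,
      h.vis w]
    split_ifs <;> tauto
  start j hj := by
    rw [Function.update_of_ne (by simp only [startBase]; omega), h.start j hj]
  aux j hj := by
    rw [Function.update_of_ne (by simp only [auxBase, startBase]; omega), h.aux j hj]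

theorem update_start (h : Arrays G ℓ cur tgt que S st aux m) {i : ℕ} (hi : i < n) (k : ℕ) :
    Arrays G ℓ cur tgt que S (Function.update st i k) aux
      (Function.update m (startBase n ℓ + i) k) where
  cur j hj := by
    rw [Function.update_of_ne (by simp only [startBase, visBase, queBase, adjBase]; omega),
      h.cur j hj]
  tgt j hj := by
    rw [Function.update_of_ne (by simp only [startBase, visBase, queBase, adjBase]; omega),
      h.tgt j hj]
  adj u w := by
    have := row_lt u w
    rw [Function.update_of_ne (by simp only [startBase, visBase, queBase]; omega), h.adj u w]
  que j hj := by
    rw [Function.update_of_ne (by simp only [startBase, visBase]; omega), h.que j hj]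
  vis w := by
    rw [Function.update_of_ne (by simp only [startBase]; omega), h.vis w]
  start j hj := by
    simp only [Function.update_apply, Nat.add_left_cancel_iff]
    split_ifs <;> simp [h.start j hj]
  aux j hj := by
    rw [Function.update_of_ne (by simp only [auxBase]; omega), h.aux j hj]

/-- This array is the last one, so no bound on `i` is needed to spare the others. -/
theorem update_aux (h : Arrays G ℓ cur tgt que S st aux m) {i : ℕ} (v : Fin n) :
    Arrays G ℓ cur tgt que S st (Function.update aux i v)
      (Function.update m (auxBase n ℓ + i) v) where
  cur j hj := by
    rw [Function.update_of_ne (by simp only [auxBase, startBase, visBase, queBase, adjBase]; omega),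
      h.cur j hj]
  tgt j hj := by
    rw [Function.update_of_ne (by simp only [auxBase, startBase, visBase, queBase, adjBase]; omega),
      h.tgt j hj]
  adj u w := by
    have := row_lt u w
    rw [Function.update_of_ne (by simp only [auxBase, startBase, visBase, queBase]; omega),
      h.adj u w]
  que j hj := by
    rw [Function.update_of_ne (by simp only [auxBase, startBase, visBase]; omega), h.que j hj]
  vis w := by
    rw [Function.update_of_ne (by simp only [auxBase, startBase]; omega), h.vis w]
  start j hj := by
    rw [Function.update_of_ne (by simp only [auxBase]; omega), h.start j hj]
  aux j hj := by
    simp only [Function.update_apply, Nat.add_left_cancel_iff]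
    split_ifs <;> simp [h.aux j hj]

end Arrays

/-- `d := A[u, v]` for the adjacency matrix `A` -/
def loadAdj (d u v : ℕ) : Prog :=
  block [.instr (.mul d 2 u), .instr (.add d d v), loadAt d 6 d]

theorem runs_loadAdj {W T n ℓ : ℕ} {ρ m : ℕ → ℕ} {o : List ℕ} {Q : ℕ → State → Prop} {d u v : ℕ}
    {G : SimpleGraph (Fin n)} {cur tgt que : ℕ → Fin n} {S : Set (Fin n)} {st : ℕ → ℕ}
    {aux : ℕ → Fin n} (hW : auxBase n ℓ + n ≤ W) (hρ : Consts n ℓ ρ)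
    (hm : Arrays G ℓ cur tgt que S st aux m) (hd : 6 < d) (hdv : d ≠ v) {x y : Fin n}
    (hx : ρ u = x) (hy : ρ v = y) (hT : 4 ≤ T)
    (h : Q (T - 4) ⟨Function.update ρ d (if G.Adj x y then 1 else 0), m, o⟩) :
    Runs W (loadAdj d u v) T ⟨ρ, m, o⟩ Q := by
  have h1 := row_lt x y
  simp only [auxBase, startBase, visBase, queBase] at hW
  have h6 : (6 : ℕ) ≠ d := by omega
  simp only [loadAdj, runs_block_cons, runs_block_nil, runs_mul, runs_add, runs_loadAt,
    Function.update_self, Function.update_idem, Function.update_of_ne hdv.symm,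
    Function.update_of_ne h6, hρ.num, hρ.adj, hx, hy, hm.adj, Nat.sub_sub]
  refine ⟨by omega, by omega, by omega, by omega, by omega, by omega, ?_, h⟩
  have := x.2
  split_ifs <;> omega

/-! ### Breadth-first search -/

/-- The cells `0, …, tail - 1` of `que` enumerate the set `S` without repetition. -/
structure Enumerates {V : Type*} (que : ℕ → V) (tail : ℕ) (S : Set V) : Prop where
  inj : ∀ i < tail, ∀ j < tail, que i = que j → i = j
  mem_iff : ∀ v, v ∈ S ↔ ∃ i < tail, que i = v

/-- Ensures that the queue never outgrows its `n` cells. -/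
theorem Enumerates.le {n : ℕ} {que : ℕ → Fin n} {tail : ℕ} {S : Set (Fin n)}
    (h : Enumerates que tail S) : tail ≤ n := by
  have : Function.Injective fun i : Fin tail => que i := fun i j hij =>
    Fin.ext (h.inj i i.2 j j.2 hij)
  simpa using Fintype.card_le_of_injective _ this

theorem Enumerates.push {V : Type*} {que : ℕ → V} {tail : ℕ} {S : Set V}
    (h : Enumerates que tail S) {v : V} (hv : v ∉ S) :
    Enumerates (Function.update que tail v) (tail + 1) (insert v S) where
  inj i hi j hj hij := by
    have key : ∀ i < tail, que i ≠ v := fun i hi he => hv ((h.mem_iff v).mpr ⟨i, hi, he⟩)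
    simp only [Function.update_apply] at hij
    split_ifs at hij with h1 h2 h2
    · omega
    · exact (key j (by omega) hij.symm).elim
    · exact (key i (by omega) hij).elim
    · exact h.inj i (by omega) j (by omega) hij
  mem_iff w := by
    rw [Set.mem_insert_iff, h.mem_iff]
    constructor
    · rintro (rfl | ⟨i, hi, rfl⟩)
      · exact ⟨tail, by omega, by simp⟩
      · exact ⟨i, by omega, by rw [Function.update_of_ne (by omega)]⟩
    · rintro ⟨i, hi, rfl⟩
      by_cases h1 : i = tail
      · subst h1; simp
      · exact Or.inr ⟨i, by omega, by rw [Function.update_of_ne h1]⟩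

/-- Append the vertex in register `17` to the queue. -/
def pushVertex : Prog :=
  block [storeAt 18 7 12 17, .instr (.add 12 12 1), storeAt 18 8 17 1]

/-- Append the unvisited neighbours of the vertex in register `16` to the queue. -/
def scanBody : Prog :=
  block [loadAdj 18 16 17, loadAt 19 8 17, .cond (.lt 19 18) pushVertex .skip,
    .instr (.add 17 17 1)]

def scan : Prog := .loop (.lt 17 2) scanBody

section BFS

variable {W T n ℓ : ℕ} {ρ m : ℕ → ℕ} {o : List ℕ} {G : SimpleGraph (Fin n)}
  {cur tgt que aux : ℕ → Fin n} {S : Set (Fin n)} {st : ℕ → ℕ} {tail : ℕ}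

theorem runs_scan (hW : auxBase n ℓ + n ≤ W) (hρ : Consts n ℓ ρ)
    (hm : Arrays G ℓ cur tgt que S st aux m) (hq : Enumerates que tail S) {v : Fin n}
    (h12 : ρ 12 = tail) (h16 : ρ 16 = v) (h17 : ρ 17 = 0) (hT : 14 * n + 1 ≤ T) :
    Runs W scan T ⟨ρ, m, o⟩ fun T' σ => ∃ ρ' m' que' tail', σ = ⟨ρ', m', o⟩ ∧
      Arrays G ℓ cur tgt que' (S ∪ {w | G.Adj v w}) st aux m' ∧
      Enumerates que' tail' (S ∪ {w | G.Adj v w}) ∧ tail ≤ tail' ∧ (∀ i < tail, que' i = que i) ∧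
      ρ' 12 = tail' ∧ (∀ r, r ≠ 12 → (r < 17 ∨ 19 < r) → ρ' r = ρ r) ∧ T ≤ T' + (14 * n + 1) := by
  -- Invariant: exactly the neighbours of `v` with index below `u` have been added. An iteration
  -- costs at most 14 steps: 1 for the loop test, 4 and 2 for the loads, 1 for the branch, 5 for
  -- pushing, 1 for the increment.
  refine runs_loop (fun T' σ => ∃ ρ' m' que' tail' u, σ = ⟨ρ', m', o⟩ ∧
      Arrays G ℓ cur tgt que' (S ∪ {w | G.Adj v w ∧ (w : ℕ) < u}) st aux m' ∧
      Enumerates que' tail' (S ∪ {w | G.Adj v w ∧ (w : ℕ) < u}) ∧ tail ≤ tail' ∧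
      (∀ i < tail, que' i = que i) ∧ ρ' 12 = tail' ∧ ρ' 17 = u ∧ u ≤ n ∧
      (∀ r, r ≠ 12 → (r < 17 ∨ 19 < r) → ρ' r = ρ r) ∧ T ≤ T' + 14 * u) ?_
    ⟨ρ, m, que, tail, 0, rfl, by simpa using hm, by simpa using hq, le_rfl, fun _ _ => rfl, h12,
      h17, by omega, fun _ _ _ => rfl, by omega⟩
  rintro T' σ ⟨ρ', m', que', tail', u, rfl, hm', hq', htail, hque, h12', h17', hu, hfr, hT'⟩
  have hρ' : Consts n ℓ ρ' := hρ.congr fun r hr => hfr r (by omega) (by omega)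
  have h2 := hρ'.num
  have h16' : ρ' 16 = v := by rw [hfr 16 (by omega) (by omega), h16]
  refine ⟨by omega, fun hb => ?_, fun hb => ?_⟩
  · simp only [Test.Holds, h17', h2] at hb
    have hW' := hW
    simp only [auxBase, startBase] at hW'
    obtain ⟨x, rfl⟩ : ∃ x : Fin n, u = x := ⟨⟨u, hb⟩, rfl⟩
    have hvis := hm'.vis x
    simp only [scanBody, runs_block_cons]
    refine runs_loadAdj hW hρ' hm' (by omega) (by omega) h16' h17' (by omega) ?_
    simp only [runs_block_nil, runs_loadAt, runs_cond, runs_add, runs_skip,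
      Function.update_apply, Test.Holds, Nat.reduceEqDiff, if_true, if_false, hρ'.vis, h17', hvis,
      hρ'.one]
    have hn0 := x.2
    set S' := S ∪ {w | G.Adj v w ∧ (w : ℕ) < (x : ℕ)} with hS'
    refine ⟨by omega, by omega, by split_ifs <;> omega, by omega, fun hlt => ?_, fun hlt => ?_⟩
    -- The entries are 0 or 1, so the single comparison "visited < adjacent" means adjacent and
    -- unvisited.
    · obtain ⟨hadj, hx⟩ : G.Adj v x ∧ x ∉ S' := by
        split_ifs at hlt <;> first | omega | tauto
      have hset : S ∪ {w | G.Adj v w ∧ (w : ℕ) < (x : ℕ) + 1} = insert x S' := by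
        ext w
        simp only [hS', Set.mem_union, Set.mem_ofPred_eq, Set.mem_insert_iff, Nat.lt_succ_iff_lt_or_eq,
          ← Fin.ext_iff]
        constructor
        · tauto
        · rintro (rfl | h) <;> tauto
      have hpush := hq'.push hx
      have hle := hpush.le
      simp only [pushVertex, runs_block_cons, runs_block_nil,
        runs_storeAt (show 17 ≠ 18 by omega), runs_storeAt (show 1 ≠ 18 by omega), runs_add,
        Function.update_apply, Nat.reduceEqDiff, if_false, hρ'.vis, h17', hρ'.que, h12', hρ'.one]
      have hV : visBase n ℓ = queBase n ℓ + n := rfl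
      refine ⟨by omega, by omega, by omega, by omega, by omega, by omega, by omega, by omega, _, _,
        _, tail' + 1, x + 1, rfl, hset ▸ (hm'.update_que (by omega) x).insert_vis x, hset ▸ hpush,
        by omega, fun i hi => ?_, ?_, ?_, by omega, fun r hr hr' => ?_, by omega⟩
      · rw [Function.update_of_ne (by omega), hque i hi]
      · simp
      · simp
      · simp only [Function.update_apply]
        iterate 6 rw [if_neg (by omega)]
        exact hfr r hr hr'
    · have hset : S ∪ {w | G.Adj v w ∧ (w : ℕ) < (x : ℕ) + 1} = S' := by
        ext w
        simp only [hS', Set.mem_union, Set.mem_ofPred_eq, Nat.lt_succ_iff_lt_or_eq, ← Fin.ext_iff]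
        constructor
        · rintro (h | ⟨h, h' | rfl⟩)
          · exact Or.inl h
          · exact Or.inr ⟨h, h'⟩
          · by_contra hx
            rw [if_pos h, if_neg (show w ∉ S' from hx)] at hlt
            omega
        · tauto
      refine ⟨by omega, by omega, _, m', que', tail', x + 1, rfl, hset ▸ hm', hset ▸ hq', htail, hque,
        ?_, ?_, by omega, fun r hr hr' => ?_, by omega⟩
      · simpa [Function.update_apply] using h12'
      · simp
      · simp only [Function.update_apply]
        rw [if_neg (by omega), if_neg (by omega), if_neg (by omega), hfr r hr hr']
  · simp only [Test.Holds, h17', h2] at hb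
    obtain rfl : u = n := by omega
    simp only [Fin.is_lt, and_true] at hm' hq'
    exact ⟨ρ', m', que', tail', rfl, hm', hq', htail, hque, h12', hfr, by omega⟩

/-- Scan the next vertex of the queue. -/
def scanNext : Prog :=
  block [loadAt 16 7 13, .instr (.add 13 13 1), .instr (.const 17 0), scan]

/-- Scan the vertices of the queue up to the position in register `15`. -/
def scanLayer : Prog := .loop (.lt 13 15) scanNext

/-- Cells before `lo` were scanned earlier, so scanning up to the old `tail` completes the
neighbourhood of the whole of `S`. Register `15` keeps the old `tail`, so vertices appended
meanwhile wait for the next layer. Each scanned vertex is charged `14 * n + 6`; stating the cost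
through `lo` and `tail` lets it telescope over the layers. -/
theorem runs_scanLayer (hW : auxBase n ℓ + n ≤ W) (hρ : Consts n ℓ ρ)
    (hm : Arrays G ℓ cur tgt que S st aux m) (hq : Enumerates que tail S) {lo : ℕ}
    (h12 : ρ 12 = tail) (h13 : ρ 13 = lo) (h15 : ρ 15 = tail) (hlo : lo ≤ tail)
    (hS : ∀ i < lo, ∀ w, G.Adj (que i) w → w ∈ S) (hT : (14 * n + 6) * n + 1 ≤ T + (14 * n + 6) * lo) :
    Runs W scanLayer T ⟨ρ, m, o⟩ fun T' σ => ∃ ρ' m' que' tail', σ = ⟨ρ', m', o⟩ ∧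
      Arrays G ℓ cur tgt que' (nbhd G S) st aux m' ∧
      Enumerates que' tail' (nbhd G S) ∧ tail ≤ tail' ∧ (∀ i < tail, que' i = que i) ∧
      ρ' 12 = tail' ∧ ρ' 13 = tail ∧ (∀ r, r < 12 ∨ r = 14 → ρ' r = ρ r) ∧
      T + (14 * n + 6) * lo ≤ T' + (14 * n + 6) * tail + 1 := by
  have htn := hq.le
  have hmul : ∀ a ≤ n, (14 * n + 6) * a ≤ (14 * n + 6) * n := fun a ha => Nat.mul_le_mul_left _ ha
  refine runs_loop (fun T' σ => ∃ ρ' m' que' tail' h, σ = ⟨ρ', m', o⟩ ∧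
      Arrays G ℓ cur tgt que' (S ∪ {w | ∃ i < h, G.Adj (que i) w}) st aux m' ∧
      Enumerates que' tail' (S ∪ {w | ∃ i < h, G.Adj (que i) w}) ∧ tail ≤ tail' ∧
      (∀ i < tail, que' i = que i) ∧ ρ' 12 = tail' ∧ ρ' 13 = h ∧ h ≤ tail ∧ ρ' 15 = tail ∧
      (∀ r, r < 12 ∨ r = 14 → ρ' r = ρ r) ∧
      T + (14 * n + 6) * lo ≤ T' + (14 * n + 6) * h) ?_ ?_
  · rintro T' σ ⟨ρ', m', que', tail', h, rfl, hm', hq', htail, hque, h12', h13', hh, h15', hfr, hT'⟩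
    have hρ' : Consts n ℓ ρ' := hρ.congr fun r hr => hfr r (by omega)
    have := hmul h (by omega)
    refine ⟨by omega, fun hb => ?_, fun hb => ?_⟩
    · simp only [Test.Holds, h13', h15'] at hb
      have := hmul (h + 1) (by omega)
      rw [Nat.mul_add, Nat.mul_one] at this
      have hn := (que' h).2
      have hl := hm'.que h (by omega)
      have hW' := hW
      simp only [auxBase, startBase, visBase] at hW'
      simp only [scanNext, runs_block_cons, runs_block_nil, runs_loadAt, runs_add, runs_const,
        Function.update_apply, Nat.reduceEqDiff, if_false, hρ'.que, hρ'.one, h13', hl]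
      refine ⟨by omega, by omega, by omega, by omega, by omega, by omega, by omega, ?_⟩
      refine (runs_scan hW (hρ'.congr fun r hr => ?_) hm' hq' (v := que' h) ?_ ?_ ?_ ?_).mono ?_
      · simp only [Function.update_apply]
        iterate 3 rw [if_neg (by omega)]
      · simpa using h12'
      · simp
      · simp
      · omega
      rintro T'' σ'' - ⟨ρ'', m'', que'', tail'', rfl, hm'', hq'', htail'', hque'', h12'', hfr'',
        hT''⟩
      have hset : S ∪ {w | ∃ i < h + 1, G.Adj (que i) w} =
          S ∪ {w | ∃ i < h, G.Adj (que i) w} ∪ {w | G.Adj (que' h) w} := by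
        ext w
        simp only [Set.mem_union, Set.mem_ofPred_eq, Nat.lt_succ_iff_lt_or_eq, hque h hb, or_and_right,
          exists_or, exists_eq_left, or_assoc]
      refine ⟨ρ'', m'', que'', tail'', h + 1, rfl, hset ▸ hm'', hset ▸ hq'', by omega,
        fun i hi => ?_, h12'', ?_, by omega, ?_, fun r hr => ?_, ?_⟩
      · rw [hque'' i (by omega), hque i hi]
      · rw [hfr'' 13 (by omega) (by omega)]; simp
      · rw [hfr'' 15 (by omega) (by omega)]; simpa using h15'
      · rw [hfr'' r (by omega) (by omega)]
        simp only [Function.update_apply]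
        iterate 3 rw [if_neg (by omega)]
        exact hfr r hr
      · rw [Nat.mul_add, Nat.mul_one]
        omega
    · simp only [Test.Holds, h13', h15'] at hb
      obtain rfl : h = tail := by omega
      have hset : S ∪ {w | ∃ i < h, G.Adj (que i) w} = nbhd G S := by
        ext w
        simp only [nbhd, Set.mem_union, Set.mem_ofPred_eq, hq.mem_iff]
        constructor
        · rintro (h1 | ⟨i, hi, h1⟩)
          · exact Or.inl h1
          · exact Or.inr ⟨_, ⟨i, hi, rfl⟩, h1⟩
        · rintro (h1 | ⟨_, ⟨i, hi, rfl⟩, h1⟩)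
          · exact Or.inl h1
          · exact Or.inr ⟨i, hi, h1⟩
      rw [hset] at hm' hq'
      exact ⟨ρ', m', que', tail', rfl, hm', hq', htail, hque, h12', h13', hfr, by omega⟩
  · have hset : S ∪ {w | ∃ i < lo, G.Adj (que i) w} = S := by
      ext w
      simp only [Set.mem_union, Set.mem_ofPred_eq, or_iff_left_iff_imp]
      rintro ⟨i, hi, h⟩
      exact hS i hi w h
    exact ⟨ρ, m, que, tail, lo, rfl, hset.symm ▸ hm, hset.symm ▸ hq, le_rfl, fun _ _ => rfl, h12,
      h13, hlo, h15, fun _ _ => rfl, le_rfl⟩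

/-- The vertices at distance `k` from `s`, for `k < K`, are stored in the cells
`st k, …, st (k + 1) - 1` of `que`. -/
structure Layers {V : Type*} (G : SimpleGraph V) (s : V) (K tail : ℕ) (que : ℕ → V)
    (st : ℕ → ℕ) : Prop where
  inj : ∀ i < tail, ∀ j < tail, que i = que j → i = j
  le : ∀ k ≤ K, st k ≤ tail
  mem_iff : ∀ k ≤ K, ∀ v, v ∈ walkBall G s k ↔ ∃ i < st k, que i = v

theorem walkBall_subset_of_adj {V : Type*} {G : SimpleGraph V} {s v w : V} {k : ℕ}
    (hv : v ∈ walkBall G s k) (h : G.Adj v w) : w ∈ walkBall G s (k + 1) := by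
  obtain ⟨p, hp⟩ := hv
  exact ⟨p.concat h, by simp; omega⟩

theorem Layers.succ {V : Type*} {G : SimpleGraph V} {s : V} {k tail tail' : ℕ} {que que' : ℕ → V}
    {st : ℕ → ℕ} (h : Layers G s k tail que st) (hq : Enumerates que tail (walkBall G s (k + 1)))
    (hq' : Enumerates que' tail' (walkBall G s (k + 2))) (ht : tail ≤ tail')
    (heq : ∀ i < tail, que' i = que i) :
    Layers G s (k + 1) tail' que' (Function.update st (k + 1) tail) where
  inj := hq'.inj
  le j hj := by
    by_cases hjk : j = k + 1
    · subst hjk; simpa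
    · rw [Function.update_of_ne hjk]
      exact (h.le j (by omega)).trans ht
  mem_iff j hj v := by
    by_cases hjk : j = k + 1
    · subst hjk
      rw [Function.update_self, hq.mem_iff]
      exact exists_congr fun i => and_congr_right fun hi => by rw [heq i hi]
    · rw [Function.update_of_ne hjk, h.mem_iff j (by omega)]
      have := h.le j (by omega)
      exact exists_congr fun i => and_congr_right fun hi => by rw [heq i (by omega)]

/-- Compute the next layer. -/
def nextLayer : Prog :=
  block [.instr (.move 15 12), .instr (.add 14 14 1), storeAt 18 9 14 12, scanLayer]

/-- Compute the layers `0, …, ℓ - 1`. -/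
def bfs : Prog := .loop (.lt 14 3) nextLayer

theorem runs_bfs (hW : auxBase n ℓ + n ≤ W) (hρ : Consts n ℓ ρ) {s : Fin n}
    (hm : Arrays G ℓ cur tgt que {s} st aux m) (hq : que 0 = s) (hst : st 0 = 0) (hℓ : ℓ < n)
    (h12 : ρ 12 = 1) (h13 : ρ 13 = 0) (h14 : ρ 14 = 0)
    (hT : (14 * n + 6) * n + 6 * n + 1 ≤ T) :
    Runs W bfs T ⟨ρ, m, o⟩ fun T' σ => ∃ ρ' m' que' tail' S' st', σ = ⟨ρ', m', o⟩ ∧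
      Arrays G ℓ cur tgt que' S' st' aux m' ∧ Layers G s ℓ tail' que' st' ∧ tail' ≤ n ∧
      Consts n ℓ ρ' ∧ T ≤ T' + (14 * n + 6) * n + 6 * n + 1 := by
  have hmul : ∀ a ≤ n, (14 * n + 6) * a ≤ (14 * n + 6) * n := fun a ha => Nat.mul_le_mul_left _ ha
  -- Invariant: the queue holds all vertices at distance at most `k`, and those at distance less
  -- than `k`, the first `st' k` cells, have been scanned. Besides the scanning, a layer costs 6
  -- steps.
  refine runs_loop (fun T' σ => ∃ ρ' m' que' tail' st' k, σ = ⟨ρ', m', o⟩ ∧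
      Arrays G ℓ cur tgt que' (walkBall G s (k + 1)) st' aux m' ∧
      Enumerates que' tail' (walkBall G s (k + 1)) ∧ Layers G s k tail' que' st' ∧
      ρ' 12 = tail' ∧ ρ' 13 = st' k ∧ ρ' 14 = k ∧ k ≤ ℓ ∧ Consts n ℓ ρ' ∧
      T ≤ T' + (14 * n + 6) * st' k + 6 * k) ?_ ?_
  · rintro T' σ ⟨ρ', m', que', tail', st', k, rfl, hm', hq', hl, h12', h13', h14', hk, hρ', hT'⟩
    have htn := hq'.le
    have hsk := hl.le k le_rfl
    have := hmul (st' k) (by omega)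
    refine ⟨by omega, fun hb => ?_, fun hb => ?_⟩
    · simp only [Test.Holds, h14', hρ'.len] at hb
      have hW' := hW
      simp only [auxBase] at hW'
      simp only [nextLayer, runs_block_cons, runs_block_nil, runs_move, runs_add,
        runs_storeAt (show 12 ≠ 18 by omega), Function.update_apply, Nat.reduceEqDiff, if_true,
        if_false, hρ'.start, hρ'.one, h14', h12']
      refine ⟨by omega, by omega, by omega, by omega, by omega, by omega, ?_⟩
      refine (runs_scanLayer (lo := st' k) hW (hρ'.congr fun r hr => ?_)
        (hm'.update_start (by omega) tail') hq' ?_ ?_ ?_ hsk (fun i hi w hw => ?_) (by omega)).mono ?_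
      · simp only [Function.update_apply]
        iterate 3 rw [if_neg (by omega)]
      · simpa using h12'
      · simpa using h13'
      · simp
      · exact walkBall_subset_of_adj ((hl.mem_iff k le_rfl _).mpr ⟨i, hi, rfl⟩) hw
      rintro T'' σ'' - ⟨ρ'', m'', que'', tail'', rfl, hm'', hq'', htail, hque, h12'', h13'', hfr,
        hT''⟩
      rw [← walkBall_succ] at hm'' hq''
      refine ⟨ρ'', m'', que'', tail'', _, k + 1, rfl, hm'', hq'', hl.succ hq' hq'' htail hque, h12'',
        by simpa using h13'', ?_, hb, hρ'.congr fun r hr => ?_, ?_⟩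
      · rw [hfr 14 (by omega)]; simp
      · rw [hfr r (by omega)]
        simp only [Function.update_apply]
        iterate 3 rw [if_neg (by omega)]
      · rw [Function.update_self]
        omega
    · simp only [Test.Holds, h14', hρ'.len] at hb
      obtain rfl : k = ℓ := by omega
      exact ⟨ρ', m', que', tail', _, st', rfl, hm', hl, htn, hρ', by omega⟩
  · rw [← walkBall_one] at hm
    refine ⟨ρ, m, que, 1, st, 0, rfl, hm, ⟨fun i hi j hj _ => by omega, fun v => ?_⟩,
      ⟨fun i hi j hj _ => by omega, fun k hk => ?_, fun k hk v => ?_⟩, h12, by rw [h13, hst], h14,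
      by omega, hρ, by omega⟩
    · rw [walkBall_one]
      simp [hq, eq_comm]
    · obtain rfl : k = 0 := by omega
      omega
    · obtain rfl : k = 0 := by omega
      simp [walkBall_zero, hst]

end BFS

/-! ### Reconfiguring the current path -/

/-! ### Distance layers as segments of the queue -/

theorem Layers.exists_eq {V : Type*} {G : SimpleGraph V} {s : V} {K tail : ℕ} {que : ℕ → V}
    {st : ℕ → ℕ} (h : Layers G s K tail que st) {k : ℕ} (hk : k < K) {v : V}
    (hr : G.Reachable s v) (hd : G.dist s v = k) :
    ∃ e, st k ≤ e ∧ e < st (k + 1) ∧ que e = v := by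
  obtain ⟨e, he, hv⟩ := (h.mem_iff (k + 1) hk v).mp (mem_walkBall_iff.mpr ⟨hr, by omega⟩)
  refine ⟨e, ?_, he, hv⟩
  by_contra hlt
  have := (mem_walkBall_iff.mp ((h.mem_iff k (by omega) v).mpr ⟨e, by omega, hv⟩)).2
  omega

/-- A vertex at smaller distance would already occur before cell `st k`, against injectivity of the
queue. -/
theorem Layers.dist_eq {V : Type*} {G : SimpleGraph V} {s : V} {K tail : ℕ} {que : ℕ → V}
    {st : ℕ → ℕ} (h : Layers G s K tail que st) {k : ℕ} (hk : k < K) {e : ℕ} (he : st k ≤ e)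
    (he' : e < st (k + 1)) : G.Reachable s (que e) ∧ G.dist s (que e) = k := by
  obtain ⟨hr, hd⟩ := mem_walkBall_iff.mp ((h.mem_iff (k + 1) hk _).mpr ⟨e, he', rfl⟩)
  refine ⟨hr, le_antisymm (by omega) ?_⟩
  by_contra hlt
  obtain ⟨i, hi, heq⟩ := (h.mem_iff k (by omega) _).mp (mem_walkBall_iff.mpr ⟨hr, by omega⟩)
  have := h.le k (by omega)
  have := h.le (k + 1) hk
  have := h.inj i (by omega) e (by omega) heq
  omega

/-- Test whether the next vertex of the queue is a common neighbour of the vertices in the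
registers `13` and `14`. -/
def searchBody : Prog :=
  block [loadAt 16 7 15, loadAdj 17 14 16, loadAdj 18 13 16, .instr (.mul 17 17 18),
    .instr (.add 15 15 1)]

def search : Prog := .loop (.eq 17 0) searchBody

section Main

variable {W T n ℓ : ℕ} {ρ m : ℕ → ℕ} {o : List ℕ} {G : SimpleGraph (Fin n)}
  {cur tgt que aux : ℕ → Fin n} {S : Set (Fin n)} {st : ℕ → ℕ} {tail : ℕ}

/-- The loop has no bound check: the witness at cell `e` guarantees that it stops inside the layer.
The product of the two adjacency bits signals success, and a cell costs 13 steps. -/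
theorem runs_search (hW : auxBase n ℓ + n ≤ W) (hρ : Consts n ℓ ρ)
    (hm : Arrays G ℓ cur tgt que S st aux m) {a b : Fin n} (h13 : ρ 13 = b) (h14 : ρ 14 = a)
    (h17 : ρ 17 = 0) {hi e : ℕ} (hlo : ρ 15 ≤ e) (he : e < hi) (hn : hi ≤ n)
    (hae : G.Adj a (que e)) (hbe : G.Adj b (que e)) (hT : 13 * hi + 1 ≤ T + 13 * ρ 15) :
    Runs W search T ⟨ρ, m, o⟩ fun T' σ => ∃ ρ' e', σ = ⟨ρ', m, o⟩ ∧
      ρ 15 ≤ e' ∧ e' < hi ∧ G.Adj a (que e') ∧ G.Adj b (que e') ∧ ρ' 16 = que e' ∧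
      (∀ r, r < 15 ∨ 18 < r → ρ' r = ρ r) ∧ T + 13 * ρ 15 ≤ T' + 13 * hi + 1 := by
  refine runs_loop (fun T' σ => ∃ ρ', σ = ⟨ρ', m, o⟩ ∧ (∀ r, r < 15 ∨ 18 < r → ρ' r = ρ r) ∧
    T + 13 * ρ 15 ≤ T' + 13 * ρ' 15 ∧ ρ' 15 ≤ e + 1 ∧
    (ρ' 17 = 0 ∧ ρ 15 ≤ ρ' 15 ∧ ρ' 15 ≤ e ∨ ρ' 17 ≠ 0 ∧ ∃ e', ρ 15 ≤ e' ∧ e' < hi ∧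
      G.Adj a (que e') ∧ G.Adj b (que e') ∧ ρ' 16 = que e')) ?_
    ⟨ρ, rfl, fun _ _ => rfl, le_rfl, by omega, Or.inl ⟨h17, le_rfl, hlo⟩⟩
  rintro T' σ ⟨ρ', rfl, hfr, hT', h15, hcase⟩
  have hρ' : Consts n ℓ ρ' := hρ.congr fun r hr => hfr r (by omega)
  refine ⟨by omega, fun hb => ?_, fun hb => ?_⟩
  · simp only [Test.Holds, hρ'.zero] at hb
    obtain ⟨-, hlo', he'⟩ : ρ' 17 = 0 ∧ ρ 15 ≤ ρ' 15 ∧ ρ' 15 ≤ e :=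
      hcase.resolve_right fun h => h.1 hb
    have h13' : ρ' 13 = b := by rw [hfr 13 (by omega), h13]
    have h14' : ρ' 14 = a := by rw [hfr 14 (by omega), h14]
    obtain ⟨idx, hidx⟩ : ∃ idx, ρ' 15 = idx := ⟨_, rfl⟩
    rw [hidx] at hlo' he' h15 hT'
    have hq := hm.que idx (by omega)
    have hx := (que idx).2
    have hW' := hW
    simp only [auxBase, startBase, visBase] at hW'
    simp only [searchBody, runs_block_cons, runs_loadAt, hρ'.que, hidx, hq]
    refine ⟨by omega, by omega, by omega, ?_⟩
    refine runs_loadAdj (x := a) (y := que idx) hW (hρ'.congr fun r hr => ?_) hm (by omega)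
      (by omega) (by simpa using h14') (by simp) (by omega) ?_
    · rw [Function.update_of_ne (by omega)]
    refine runs_loadAdj (x := b) (y := que idx) hW (hρ'.congr fun r hr => ?_) hm (by omega)
      (by omega) (by simpa using h13') (by simp) (by omega) ?_
    · rw [Function.update_of_ne (by omega), Function.update_of_ne (by omega)]
    simp only [runs_block_nil, runs_mul, runs_add, Function.update_apply,
      Nat.reduceEqDiff, if_true, if_false, hρ'.one, hidx]
    refine ⟨by omega, ?_, by omega, by omega, _, rfl, fun r hr => ?_, ?_, ?_, ?_⟩
    · split_ifs <;> omega
    · simp only [Function.update_apply]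
      iterate 5 rw [if_neg (by omega)]
      exact hfr r hr
    · rw [Function.update_self]
      omega
    · rw [Function.update_self]
      omega
    · simp only [Function.update_apply, Nat.reduceEqDiff, if_true, if_false]
      by_cases hab : G.Adj a (que idx) ∧ G.Adj b (que idx)
      · rw [if_pos hab.1, if_pos hab.2]
        exact Or.inr ⟨by omega, idx, hlo', by omega, hab.1, hab.2, rfl⟩
      · refine Or.inl ⟨?_, by omega, ?_⟩
        · split_ifs <;> first | rfl | tauto
        · have : idx ≠ e := by rintro rfl; exact hab ⟨hae, hbe⟩
          omega
  · simp only [Test.Holds, hρ'.zero] at hb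
    obtain ⟨-, e', h1, h2, h3, h4, h5⟩ := hcase.resolve_left fun h => hb h.1
    exact ⟨ρ', e', rfl, h1, h2, h3, h4, h5, hfr, by omega⟩

/-- Given the vertices in register `13` and at the position `i` of the current path, where `i` is
the content of register `12`, store a common neighbour of theirs in the preceding layer. -/
def descendBody : Prog :=
  block [loadAt 14 4 12, .instr (.sub 12 12 1), loadAt 15 9 12, .instr (.const 17 0), search,
    .instr (.move 13 16), storeAt 18 10 12 16]

def descend : Prog := .loop (.lt 0 12) descendBody

/-- A step into layer `k` costs at most `13 * (st (k + 1) - st k) + 11`. The sum telescopes to at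
most `13 * st j + 11 * j ≤ 24 * n`. -/
theorem runs_descend (hG : WeaklyModular G) (hW : auxBase n ℓ + n ≤ W) (hρ : Consts n ℓ ρ)
    (hm : Arrays G ℓ cur tgt que S st aux m) {s : Fin n} (hl : Layers G s ℓ tail que st)
    (htn : tail ≤ n) (hℓ : ℓ < n) {j : ℕ} (hj : j < ℓ)
    (hcur : ∀ i < ℓ, G.Adj (cur i) (cur (i + 1))) (hdist : ∀ i ≤ ℓ, G.dist s (cur i) = i)
    (h12 : ρ 12 = j) (h13 : ρ 13 = aux j) (hr : G.Reachable s (aux j))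
    (hd : G.dist s (aux j) = j) (hadj : G.Adj (aux j) (cur (j + 1))) (hT : 24 * n + 1 ≤ T) :
    Runs W descend T ⟨ρ, m, o⟩ fun T' σ => ∃ ρ' m' x, σ = ⟨ρ', m', o⟩ ∧
      Arrays G ℓ cur tgt que S st x m' ∧ x 0 = s ∧ x j = aux j ∧
      (∀ i < j, G.Adj (x i) (x (i + 1))) ∧ (∀ i ≤ j, G.Adj (x i) (cur (i + 1))) ∧
      (∀ r, r < 12 ∨ 18 < r → ρ' r = ρ r) ∧ T ≤ T' + 24 * n + 1 := by
  have hstn : ∀ i ≤ ℓ, st i ≤ n := fun i hi => (hl.le i hi).trans htn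
  refine runs_loop (fun T' σ => ∃ ρ' m' x i, σ = ⟨ρ', m', o⟩ ∧
      Arrays G ℓ cur tgt que S st x m' ∧ i ≤ j ∧ ρ' 12 = i ∧ ρ' 13 = x i ∧ G.Reachable s (x i) ∧
      G.dist s (x i) = i ∧ x j = aux j ∧
      (∀ i', i ≤ i' → i' < j → G.Adj (x i') (x (i' + 1))) ∧
      (∀ i', i ≤ i' → i' ≤ j → G.Adj (x i') (cur (i' + 1))) ∧
      (∀ r, r < 12 ∨ 18 < r → ρ' r = ρ r) ∧
      T + 13 * st i + 11 * i ≤ T' + 13 * st j + 11 * j) ?_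
    ⟨ρ, m, aux, j, rfl, hm, le_rfl, h12, h13, hr, hd, rfl, fun _ _ _ => by omega,
      fun i h1 h2 => by rwa [show i = j by omega], fun _ _ => rfl, le_rfl⟩
  rintro T' σ ⟨ρ', m', x, i, rfl, hm', hij, h12', h13', hr', hd', hxj, hxx, hxc, hfr, hT'⟩
  have hρ' : Consts n ℓ ρ' := hρ.congr fun r hr => hfr r (by omega)
  have := hstn j (by omega)
  refine ⟨by omega, fun hb => ?_, fun hb => ?_⟩
  · simp only [Test.Holds, hρ'.zero, h12'] at hb
    obtain ⟨k, rfl⟩ : ∃ k, i = k + 1 := ⟨i - 1, by omega⟩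
    -- The only appeal to weak modularity in the algorithm. It shows that the search succeeds; the
    -- vertex found may differ from `y`.
    obtain ⟨y, hy, hyc, hyx⟩ := hG.quadrangle k s (cur (k + 1)) (x (k + 1)) (cur (k + 2))
      (hdist _ (by omega)) hd' (hdist _ (by omega)) (hcur _ (by omega)) (hxc _ le_rfl hij)
    obtain ⟨e, he, he', rfl⟩ := hl.exists_eq (by omega) (hr'.trans hyx.symm.reachable) hy
    have hc := hm'.cur (k + 1) (by omega)
    have hst := hm'.start k (by omega)
    have hn0 := (cur (k + 1)).2
    have hstk := hstn k (by omega)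
    have hstk' := hstn (k + 1) (by omega)
    have hW' := hW
    simp only [auxBase, startBase, visBase, queBase, adjBase] at hW'
    have hs : startBase n ℓ + n + n ≤ W := hW
    simp only [descendBody, runs_block_cons, runs_loadAt, runs_sub, runs_const,
      Function.update_apply, Nat.reduceEqDiff, if_true, if_false, hρ'.cur, hρ'.one, hρ'.start,
      h12', hc, Nat.add_sub_cancel, hst]
    refine ⟨by omega, by omega, by omega, by omega, by omega, by omega, by omega, by omega,
      by omega, by omega, ?_⟩
    refine (runs_search hW (hρ'.congr fun r hr => ?_) hm' (a := cur (k + 1)) (b := x (k + 1))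
      ?_ ?_ ?_ (hi := st (k + 1)) (e := e) ?_ he' hstk' hyc.symm hyx.symm ?_).mono ?_
    · simp only [Function.update_apply]
      iterate 4 rw [if_neg (by omega)]
    · simpa using h13'
    · simp
    · simp
    · simpa using he
    · simp
      omega
    rintro T'' σ'' - ⟨ρ'', e', rfl, h1, h2, h3, h4, h5, hfr'', hT''⟩
    simp only [Function.update_apply, Nat.reduceEqDiff, if_true, if_false] at h1 hT''
    obtain ⟨hre, hde⟩ := hl.dist_eq (by omega) h1 h2
    have h12'' : ρ'' 12 = k := by
      rw [hfr'' 12 (by omega)]; simp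
    have hfr2 : ∀ r, r < 12 ∨ 18 < r → ρ'' r = ρ' r := fun r hr => by
      rw [hfr'' r (by omega)]
      simp only [Function.update_apply]
      iterate 4 rw [if_neg (by omega)]
    have hρ'' : Consts n ℓ ρ'' := hρ'.congr fun r hr => hfr2 r (by omega)
    have hx := (que e').2
    simp only [runs_block_nil, runs_move, runs_storeAt (show 16 ≠ 18 by omega),
      Function.update_apply, Nat.reduceEqDiff, if_false, hρ''.aux, h12'', h5]
    refine ⟨by omega, by omega, by omega, by omega, _, _, _, k, rfl, hm'.update_aux (que e'),
      by omega, by simpa using h12'', by simp, by simpa using hre, by simpa using hde, ?_,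
      fun i' h1 h2 => ?_, fun i' h1 h2 => ?_, fun r hr => ?_, by omega⟩
    · rw [Function.update_of_ne (by omega), hxj]
    · rw [Function.update_of_ne (show i' + 1 ≠ k by omega)]
      by_cases h : i' = k
      · subst h
        rw [Function.update_self]
        exact h4.symm
      · rw [Function.update_of_ne h]
        exact hxx i' (by omega) h2
    · by_cases h : i' = k
      · subst h
        rw [Function.update_self]
        exact h3.symm
      · rw [Function.update_of_ne h]
        exact hxc i' (by omega) h2
    · rw [Function.update_of_ne (by omega), Function.update_of_ne (by omega), hfr2 r hr, hfr r hr]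
  · simp only [Test.Holds, hρ'.zero, h12'] at hb
    obtain rfl : i = 0 := by omega
    exact ⟨ρ', m', x, rfl, hm', (hr'.dist_eq_zero_iff.mp hd').symm, hxj,
      fun i' => hxx i' (by omega), fun i' => hxc i' (by omega), hfr, by omega⟩

/-- Move the current path, at the position in register `12`, to the vertex stored in the auxiliary
array. -/
def moveBody : Prog :=
  block [loadAt 14 4 12, loadAt 13 10 12,
    .cond (.eq 14 13) .skip (block [.instr (.print 12), .instr (.print 13), storeAt 18 4 12 13]),
    .instr (.add 12 12 1)]

def moveAll : Prog := .loop (.lt 12 19) moveBody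

/-- Increasing positions are essential, since the intermediate paths are the splices in `hpath`. A
position where both sequences agree is skipped, as a move has to change the vertex. -/
theorem runs_moveAll (hW : auxBase n ℓ + n ≤ W) (hρ : Consts n ℓ ρ)
    (hm : Arrays G ℓ cur tgt que S st aux m) {s t : Fin n} (hℓ : ℓ < n) {j : ℕ} (hj : j < ℓ)
    (hpath : ∀ i ≤ j + 1, IsShortestPath G s t (fun i' : Fin (ℓ + 1) => splice aux cur i i'))
    {P : Fin (ℓ + 1) → Fin n}
    (hM : ∃ M, IsReconfiguration G s t (fun i : Fin (ℓ + 1) => cur i) P M ∧ o = 1 :: encodeMoves M)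
    (h12 : ρ 12 = 0) (h19 : ρ 19 = j + 1) (hT : 11 * n + 1 ≤ T) :
    Runs W moveAll T ⟨ρ, m, o⟩ fun T' σ => ∃ ρ' m' o', σ = ⟨ρ', m', o'⟩ ∧
      Arrays G ℓ (splice aux cur (j + 1)) tgt que S st aux m' ∧
      (∃ M, IsReconfiguration G s t (fun i : Fin (ℓ + 1) => splice aux cur (j + 1) i) P M ∧
        o' = 1 :: encodeMoves M) ∧
      (∀ r, r < 12 → ρ' r = ρ r) ∧ T ≤ T' + 11 * n + 1 := by
  refine runs_loop (fun T' σ => ∃ ρ' m' o' i, σ = ⟨ρ', m', o'⟩ ∧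
      Arrays G ℓ (splice aux cur i) tgt que S st aux m' ∧
      (∃ M, IsReconfiguration G s t (fun i' : Fin (ℓ + 1) => splice aux cur i i') P M ∧
        o' = 1 :: encodeMoves M) ∧ ρ' 12 = i ∧ i ≤ j + 1 ∧
      (∀ r, r < 12 ∨ r = 19 → ρ' r = ρ r) ∧ T ≤ T' + 11 * i) ?_
    ⟨ρ, m, o, 0, rfl, by rwa [splice_zero], by rwa [splice_zero], h12, by omega,
      fun _ _ => rfl, by omega⟩
  rintro T' σ ⟨ρ', m', o', i, rfl, hm', ⟨M, hM, rfl⟩, h12', hi, hfr, hT'⟩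
  have hρ' : Consts n ℓ ρ' := hρ.congr fun r hr => hfr r (by omega)
  have h19' : ρ' 19 = j + 1 := by rw [hfr 19 (by omega), h19]
  refine ⟨by omega, fun hb => ?_, fun hb => ?_⟩
  · simp only [Test.Holds, h12', h19'] at hb
    have hc := hm'.cur i (by omega)
    have hx := hm'.aux i (by omega)
    have hn1 := (splice aux cur i i).2
    have hn2 := (aux i).2
    have hW' := hW
    simp only [auxBase, startBase, visBase, queBase, adjBase] at hW'
    have hpi := hpath (i + 1) (by omega)
    rw [splice_succ] at hpi
    rw [restrict_update _ (show i < ℓ + 1 by omega)] at hpi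
    simp only [moveBody, runs_block_cons, runs_block_nil, runs_loadAt, runs_cond, runs_skip,
      runs_print, runs_add, runs_storeAt (show 13 ≠ 18 by omega), Test.Holds,
      Function.update_apply, Nat.reduceEqDiff, if_true, if_false, hρ'.cur, hρ'.one, hρ'.aux, h12',
      hc, hx, ← Fin.ext_iff]
    refine ⟨by omega, by omega, by omega, by omega, by omega, by omega, by omega,
      fun heq => ⟨by omega, by omega, _, _, _, i + 1, rfl, ?_, ⟨M, ?_, rfl⟩, by simp, by omega,
        fun r hr => ?_, by omega⟩,
      fun hne => ⟨by omega, by omega, by omega, by omega, by omega, by omega, _, _, _, i + 1, rfl,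
        ?_, ⟨M ++ [(⟨i, by omega⟩, aux i)], ?_, ?_⟩, by simp, by omega, fun r hr => ?_,
        by omega⟩⟩
    · rwa [splice_succ, ← heq, Function.update_eq_self]
    · rwa [splice_succ, ← heq, Function.update_eq_self]
    · simp only [Function.update_apply]
      iterate 3 rw [if_neg (by omega)]
      exact hfr r hr
    · rw [splice_succ]
      exact hm'.update_cur (by omega) (aux i)
    · rw [splice_succ, restrict_update _ (show i < ℓ + 1 by omega)]
      exact hM.concat (fun h => hne h.symm) hpi
    · simp [encodeMoves]
    · simp only [Function.update_apply]
      iterate 4 rw [if_neg (by omega)]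
      exact hfr r hr
  · simp only [Test.Holds, h12', h19'] at hb
    obtain rfl : i = j + 1 := by omega
    exact ⟨ρ', m', _, rfl, hm', ⟨M, hM, rfl⟩, fun r hr => hfr r (by omega), by omega⟩

/-- Adjust the current path to the target path at the position preceding the one in register
`11`. -/
def fixBody : Prog :=
  block [.instr (.sub 11 11 1), .instr (.move 12 11), loadAt 13 5 12, storeAt 18 10 12 13, descend,
    .instr (.const 12 0), .instr (.add 19 11 1), moveAll]

def fixAll : Prog := .loop (.lt 0 11) fixBody

theorem runs_fixAll (hG : WeaklyModular G) (hW : auxBase n ℓ + n ≤ W) (hρ : Consts n ℓ ρ)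
    (hm : Arrays G ℓ cur tgt que S st aux m) {s t : Fin n} (hl : Layers G s ℓ tail que st)
    (htn : tail ≤ n) (hℓ : ℓ < n)
    (hP : IsShortestPath G s t (fun i : Fin (ℓ + 1) => cur i))
    (hQ : IsShortestPath G s t (fun i : Fin (ℓ + 1) => tgt i))
    (h11 : ρ 11 = ℓ) (ho : o = [1]) (hT : (35 * n + 13) * n + 1 ≤ T) :
    Runs W fixAll T ⟨ρ, m, o⟩ fun _ σ => ∃ M, IsReconfiguration G s t
      (fun i : Fin (ℓ + 1) => tgt i) (fun i : Fin (ℓ + 1) => cur i) M ∧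
        σ.out = 1 :: encodeMoves M := by
  obtain ⟨hq0, hqℓ, hqadj, hℓd⟩ := isShortestPath_restrict_iff.mp hQ
  have hqdist : ∀ i ≤ ℓ, G.Reachable s (tgt i) ∧ G.dist s (tgt i) = i := fun i hi => by
    have := dist_of_shortest hqadj (by rw [hq0, hqℓ, ← hℓd]) hi
    rwa [hq0] at this
  have hmul : (35 * n + 13) * ℓ ≤ (35 * n + 13) * n := Nat.mul_le_mul_left _ hℓ.le
  -- Invariant: the current path `p` agrees with the target from position `c` on. A round costs at
  -- most `24 * n + 1` for the descent, `11 * n + 1` for the moves and a few further steps, within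
  -- `35 * n + 13`.
  refine runs_loop (fun T' σ => ∃ ρ' m' o' p x c, σ = ⟨ρ', m', o'⟩ ∧
      Arrays G ℓ p tgt que S st x m' ∧ Consts n ℓ ρ' ∧ ρ' 11 = c ∧ c ≤ ℓ ∧
      (∀ i, c ≤ i → i ≤ ℓ → p i = tgt i) ∧
      IsShortestPath G s t (fun i : Fin (ℓ + 1) => p i) ∧
      (∃ M, IsReconfiguration G s t (fun i : Fin (ℓ + 1) => p i)
        (fun i : Fin (ℓ + 1) => cur i) M ∧ o' = 1 :: encodeMoves M) ∧
      (35 * n + 13) * c + 1 ≤ T') ?_ ?_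
  · rintro T' σ ⟨ρ', m', o', p, x, c, rfl, hm', hρ', h11', hc, hpq, hp, hM, hT'⟩
    refine ⟨by omega, fun hb => ?_, fun hb => ?_⟩
    · simp only [Test.Holds, hρ'.zero, h11'] at hb
      obtain ⟨j, rfl⟩ : ∃ j, c = j + 1 := ⟨c - 1, by omega⟩
      rw [Nat.mul_add, Nat.mul_one] at hT'
      obtain ⟨hp0, hpℓ, hpadj, -⟩ := isShortestPath_restrict_iff.mp hp
      have hpdist : ∀ i ≤ ℓ, G.dist s (p i) = i := fun i hi => by
        have := (dist_of_shortest hpadj (by rw [hp0, hpℓ, ← hℓd]) hi).2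
        rwa [hp0] at this
      have ht := hm'.tgt j (by omega)
      have hn0 := (tgt j).2
      have hW' := hW
      have hW2 : startBase n ℓ + n + n ≤ W := hW
      simp only [auxBase, startBase, visBase, queBase, adjBase] at hW'
      simp only [fixBody, runs_block_cons, runs_block_nil, runs_sub, runs_move, runs_loadAt,
        runs_storeAt (show 13 ≠ 18 by omega), Function.update_apply, Nat.reduceEqDiff, if_true,
        if_false, h11', hρ'.one, hρ'.tgt, hρ'.aux, Nat.add_sub_cancel, ht]
      refine ⟨by omega, by omega, by omega, by omega, by omega, by omega, by omega, by omega,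
        by omega, ?_⟩
      refine (runs_descend hG hW (hρ'.congr fun r hr => ?_) (hm'.update_aux (i := j) (tgt j)) hl htn
        hℓ hc hpadj hpdist ?_ ?_ ?_ ?_ ?_ ?_).mono ?_
      · simp only [Function.update_apply]
        iterate 4 rw [if_neg (by omega)]
      · simp
      · simp
      · simpa using (hqdist j (by omega)).1
      · simpa using (hqdist j (by omega)).2
      · rw [Function.update_self, hpq (j + 1) le_rfl hc]
        exact hqadj j hc
      · omega
      rintro T'' σ'' - ⟨ρ'', m'', x', rfl, hm'', hx0, hxj, hxx, hxp, hfr, hT''⟩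
      rw [Function.update_self] at hxj
      have h11'' : ρ'' 11 = j := by rw [hfr 11 (by omega)]; simp
      have hρ'' : Consts n ℓ ρ'' := hρ'.congr fun r hr => by
        rw [hfr r (by omega)]
        simp only [Function.update_apply]
        iterate 4 rw [if_neg (by omega)]
      simp only [runs_const, runs_add, Function.update_apply, Nat.reduceEqDiff, if_false, h11'',
        hρ''.one]
      refine ⟨by omega, by omega, by omega, by omega, ?_⟩
      have hspl := fun i hi => hp.splice hc hx0 hxx hxp (i := i) hi
      refine (runs_moveAll hW (hρ''.congr fun r hr => ?_) hm'' hℓ hc hspl hM ?_ ?_ ?_).mono ?_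
      · rw [Function.update_of_ne (by omega), Function.update_of_ne (by omega)]
      · simp
      · simp
      · omega
      rintro T3 σ3 - ⟨ρ3, m3, o3, rfl, hm3, hM3, hfr3, hT3⟩
      refine ⟨ρ3, m3, o3, _, x', j, rfl, hm3, hρ''.congr fun r hr => ?_, ?_, by omega,
        fun i h1 h2 => ?_, hspl (j + 1) le_rfl, hM3, by omega⟩
      · rw [hfr3 r (by omega), Function.update_of_ne (by omega), Function.update_of_ne (by omega)]
      · rw [hfr3 11 (by omega)]; simpa using h11''
      · unfold splice
        split_ifs with h
        · obtain rfl : i = j := by omega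
          exact hxj
        · exact hpq i (by omega) h2
    · simp only [Test.Holds, hρ'.zero, h11'] at hb
      obtain rfl : c = 0 := by omega
      obtain ⟨M, hM, rfl⟩ := hM
      refine ⟨M, ?_, rfl⟩
      have : (fun i : Fin (ℓ + 1) => tgt i) = fun i : Fin (ℓ + 1) => p i :=
        funext fun i => (hpq i (by omega) (by omega)).symm
      rwa [this]
  · refine ⟨ρ, m, o, cur, aux, ℓ, rfl, hm, hρ, h11, le_rfl, fun i h1 h2 => ?_, hP,
      ⟨[], ⟨hP, rfl⟩, by simp [ho, encodeMoves]⟩, by omega⟩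
    obtain rfl : i = ℓ := by omega
    rw [hqℓ, (isShortestPath_restrict_iff.mp hP).2.1]

end Main

/-! ### The whole algorithm -/

/-- Load the parameters of the instance and mark `s` as visited. -/
def setup : Prog :=
  block [.instr (.const 1 1), .instr (.load 2 0), .instr (.load 3 1), .instr (.const 4 4),
    .instr (.add 5 3 4), .instr (.add 5 5 1), .instr (.add 6 5 3), .instr (.add 6 6 1),
    .instr (.mul 7 2 2), .instr (.add 7 7 6), .instr (.add 8 7 2), .instr (.add 9 8 2),
    .instr (.add 10 9 2), .instr (.const 11 2), .instr (.load 11 11), storeAt 18 7 0 11,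
    storeAt 18 8 11 1, .instr (.const 12 1)]

def reconfigure : Prog :=
  block [setup, bfs, .instr (.print 1), .instr (.move 11 3), fixAll]

section Final

variable {n ℓ : ℕ} {G : SimpleGraph (Fin n)} {s t : Fin n} {P Q : Fin (ℓ + 1) → Fin n}

/-- An infinite sequence extending a finite one. -/
def extend {V : Type*} (P : Fin (ℓ + 1) → V) (i : ℕ) : V := P (Fin.ofNat (ℓ + 1) i)

theorem extend_of_le {V : Type*} (P : Fin (ℓ + 1) → V) {i : ℕ} (hi : i ≤ ℓ) :
    extend P i = P ⟨i, by omega⟩ := by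
  unfold extend
  congr 1
  exact Fin.ext (Nat.mod_eq_of_lt (by omega))

theorem restrict_extend {V : Type*} (P : Fin (ℓ + 1) → V) :
    (fun i : Fin (ℓ + 1) => extend P i) = P :=
  funext fun i => extend_of_le P (by omega)

theorem getD_append_length_add {α : Type*} (l₁ l₂ : List α) (k i : ℕ) (hk : l₁.length = k) (d : α) :
    (l₁ ++ l₂).getD (k + i) d = l₂.getD i d := by
  subst hk
  simp [List.getD_eq_getElem?_getD, List.getElem?_append_right]

theorem getD_ofFn {α : Type*} {k : ℕ} (f : Fin k → α) {i : ℕ} (hi : i < k) (d : α) :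
    (List.ofFn f).getD i d = f ⟨i, hi⟩ := by
  simp [List.getD_eq_getElem?_getD, hi]

/-- Cells beyond the input are zero, so the queue and the auxiliary array initially consist of
vertex 0, which exists because `s` does. -/
theorem arrays_initState (G : SimpleGraph (Fin n)) (s t : Fin n) (P Q : Fin (ℓ + 1) → Fin n) :
    Arrays G ℓ (extend P) (extend Q) (fun _ => ⟨0, s.pos⟩) ∅ (fun _ => 0) (fun _ => ⟨0, s.pos⟩)
      (initState (encodeInstance G s t P Q)).mem := by
  have hlen : (encodeInstance G s t P Q).length = 6 + 2 * ℓ + n * n := by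
    simp [encodeInstance]; omega
  have hzero : ∀ a, 6 + 2 * ℓ + n * n ≤ a → (encodeInstance G s t P Q).getD a 0 = 0 := fun a ha => by
    rw [List.getD_eq_default _ _ (by omega)]
  constructor <;> simp only [initState]
  · intro i hi
    simp only [encodeInstance, List.append_assoc]
    rw [getD_append_length_add _ _ 4 _ (by simp), List.getD_append _ _ _ _ (by simp; omega),
      getD_ofFn _ (by omega), extend_of_le P hi]
  · intro i hi
    simp only [encodeInstance]
    rw [List.append_assoc, getD_append_length_add _ _ (5 + ℓ) _ (by simp; omega),
      List.getD_append _ _ _ _ (by simp; omega), getD_ofFn _ (by omega), extend_of_le Q hi]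
  · intro u v
    simp only [encodeInstance, adjBase]
    have h := row_lt u v
    rw [getD_append_length_add _ _ (6 + 2 * ℓ) _ (by simp; omega), getD_ofFn _ h]
    have h1 : (⟨n * u + v, h⟩ : Fin (n * n)).divNat = u := by
      ext
      simp [Fin.divNat, Nat.mul_add_div s.pos, Nat.div_eq_of_lt v.2]
    have h2 : (⟨n * u + v, h⟩ : Fin (n * n)).modNat = v := by
      ext
      simp [Fin.modNat, Nat.mod_eq_of_lt v.2]
    rw [h1, h2]
  · intro i hi
    exact hzero _ (by simp only [queBase, adjBase]; omega)
  · intro v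
    simp only [Set.mem_empty_iff_false, if_false]
    exact hzero _ (by simp only [visBase, queBase, adjBase]; omega)
  · intro i hi
    exact hzero _ (by simp only [startBase, visBase, queBase, adjBase]; omega)
  · intro i hi
    exact hzero _ (by simp only [auxBase, startBase, visBase, queBase, adjBase]; omega)

/-- The number 200 is generous: addresses stay below `n * n + 6 * n + 6`, and the leading term of
the running time is `(14 + 35) * n ^ 2`. -/
theorem runs_reconfigure (hG : WeaklyModular G) (hP : IsShortestPath G s t P)
    (hQ : IsShortestPath G s t Q) :
    Runs (200 * n ^ 2) reconfigure (200 * n ^ 2) (initState (encodeInstance G s t P Q)) fun _ σ =>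
      ∃ M, IsReconfiguration G s t Q P M ∧ σ.out = 1 :: encodeMoves M := by
  have hn := s.pos
  have hP' := hP
  have hQ' := hQ
  rw [← restrict_extend P] at hP'
  rw [← restrict_extend Q] at hQ'
  -- A geodesic repeats no vertex.
  have hℓ : ℓ < n := by
    obtain ⟨h1, h2, h3, h4⟩ := isShortestPath_restrict_iff.mp hP'
    have hr := (dist_of_shortest h3 (by rw [h1, h2, ← h4]) le_rfl).1
    rw [h1, h2] at hr
    obtain ⟨w, hw, hwl⟩ := hr.exists_path_of_dist
    have := hw.length_lt
    rw [Fintype.card_fin] at this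
    omega
  have h1 : n ≤ n * n := Nat.le_mul_self n
  have hsq : 200 * n ^ 2 = 200 * (n * n) := by rw [sq]
  have hmem0 : (initState (encodeInstance G s t P Q)).mem 0 = n := rfl
  have hmem1 : (initState (encodeInstance G s t P Q)).mem 1 = ℓ := rfl
  have hmem2 : (initState (encodeInstance G s t P Q)).mem 2 = s := rfl
  have hm := arrays_initState G s t P Q
  rw [show initState (encodeInstance G s t P Q) =
    ⟨fun _ => 0, (initState (encodeInstance G s t P Q)).mem, []⟩ from rfl]
  generalize (initState (encodeInstance G s t P Q)).mem = m at *
  rw [hsq]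
  have hs := s.2
  simp only [reconfigure, setup, runs_block_cons, runs_block_nil, runs_const, runs_load, runs_add,
    runs_mul, runs_storeAt (show 11 ≠ 18 by omega), runs_storeAt (show 1 ≠ 18 by omega),
    Function.update_apply, Nat.reduceEqDiff, if_true, if_false, hmem0, hmem1, hmem2]
  have hadj : ℓ + 4 + 1 + ℓ + 1 = adjBase ℓ := by simp only [adjBase]; omega
  have hque : n * n + adjBase ℓ = queBase n ℓ := Nat.add_comm _ _
  refine ⟨by omega, by omega, by omega, by omega, by omega, by omega, by omega, by omega,
    by omega, by omega, by omega, by omega, by omega, by omega, by omega, by omega, by omega,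
    by omega, by omega, by omega, by omega, by omega, by omega, by omega, by omega, by omega,
    by omega, by omega, by omega, by omega, by omega, by omega, by omega, by omega, by omega,
    by omega, ?_⟩
  rw [hadj, hque]
  have hW : auxBase n ℓ + n ≤ 200 * (n * n) := by
    simp only [auxBase, startBase, visBase, queBase, adjBase]
    omega
  have hm' := (hm.update_que hn s).insert_vis s
  rw [insert_empty_eq] at hm'
  have hmul : (14 * n + 6) * n = 14 * (n * n) + 6 * n := by ring
  have hmul' : (35 * n + 13) * n = 35 * (n * n) + 13 * n := by ring
  refine (runs_bfs hW ?_ hm' (by simp) rfl hℓ (by simp) (by simp) (by simp) ?_).mono ?_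
  · constructor <;> simp only [Function.update_apply, Nat.reduceEqDiff, if_true, if_false] <;>
      first | rfl | omega
  · omega
  rintro T' σ' - ⟨ρ, m', que, tail, S, st, rfl, hm'', hl, htn, hρ, hT⟩
  simp only [runs_print, runs_move, hρ.one, hρ.len]
  refine ⟨by omega, by omega, by omega, ?_⟩
  refine (runs_fixAll hG hW (hρ.congr fun r hr => ?_) hm'' hl htn hℓ hP' hQ' ?_ rfl ?_).mono ?_
  · rw [Function.update_of_ne (by omega)]
  · simp
  · omega
  · rintro T'' σ'' - ⟨M, hM, hout⟩
    rw [restrict_extend, restrict_extend] at hM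
    exact ⟨M, hM, hout⟩

end Final

/-! ### Solvability of SPR in quadratic time -/

theorem solvableInTime_of_weaklyModular {𝒢 : ∀ {n : ℕ}, SimpleGraph (Fin n) → Prop}
    (h𝒢 : ∀ {n : ℕ} (G : SimpleGraph (Fin n)), 𝒢 G → WeaklyModular G) :
    SolvableInTime 𝒢 (fun n => n ^ 2) := by
  refine ⟨reconfigure, 200, 2, fun n G hG s t ℓ P Q hP hQ => ?_⟩
  obtain ⟨τ, σ, h1, h2, M, hM, hout⟩ := runs_reconfigure (h𝒢 G hG) hP hQ
  exact ⟨τ, σ, h1, h2, Or.inr ⟨hM.reconfigurable, M, hM, hout⟩⟩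

end SPR

theorem mainTheorem5 :
    SPR.SolvableInTime (fun G => SPR.WeaklyModular G) (fun n => n ^ 2) ∧
      SPR.SolvableInTime (fun G => SPR.Bridged G) (fun n => n ^ 2) :=
  ⟨SPR.solvableInTime_of_weaklyModular fun _ h => h,
    SPR.solvableInTime_of_weaklyModular fun _ h => h.weaklyModular⟩
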